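/- Let $n\ge 1$, let $B_1$ be the open unit ball of $\mathbb{R}^n$, and let $\mu\in\mathbb{R}$. Let $u\colon\mathbb{R}^n\to\mathbb{R}$ be a function that is not identically zero and is homogeneous of degree $\mu$, i.e. $u(rx)=r^{\mu}u(x)$ for all $r>0$ and $x\in\mathbb{R}^n$. Suppose that $u$ solves the thin obstacle problem in $B_1$ (equivalently, by homogeneity, in $\mathbb{R}^n$): $u$ is continuous, even with respect to $\{x_n=0\}$, harmonic in $B_1\setminus Z(u)$, where $Z(u):=\{x_n=0\}\cap\{u=0\}$, and satisfies $$u\ge 0\quad\text{and}\quad u_n\le 0\qquad\text{on } B_1\cap\{x_n=0\},$$ where $u_n$ denotes the one-sided directional derivative of $u$ in the positive $x_n$ direction (assumed to exist at every point of $B_1\cap\{x_n=0\}$). Then $$\mu\notin\bigcup_{j\ge 0}(2j,2j+1),$$ the union being over all integers $j\ge0$. -/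

import Mathlib

namespace ThinObstacle

/-- The `n`-dimensional Euclidean space, `n = d + 1 ≥ 1`; the distinguished coordinate `x_n` is the
last one, `x (Fin.last d)`. -/
abbrev Space (d : ℕ) : Type := EuclideanSpace ℝ (Fin (d + 1))

/-- The unit vector in the positive `x_n` direction. -/
noncomputable def eLast (d : ℕ) : Space d := EuclideanSpace.single (Fin.last d) (1 : ℝ)

/-- The thin space `{x_n = 0}`. -/
def thinSpace (d : ℕ) : Set (Space d) := {x | x (Fin.last d) = 0}

/-- The reflection `(x', x_n) ↦ (x', -x_n)` across the thin space. -/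
noncomputable def reflectLast {d : ℕ} (x : Space d) : Space d :=
  x - (2 * x (Fin.last d)) • eLast d

/-- The contact set `Z(u) = {x_n = 0} ∩ {u = 0}`. -/
def contactSet {d : ℕ} (u : Space d → ℝ) : Set (Space d) :=
  thinSpace d ∩ {x | u x = 0}

/-- `u` is a solution of the thin obstacle problem in the unit ball `B_1`: a continuous function,
even with respect to the thin space, harmonic in `B_1 \ Z(u)`, with `u ≥ 0` and `u_n ≤ 0` on the
thin space, where `u_n` is the (existing) one-sided derivative in the positive `x_n` direction. -/
structure IsSolution {d : ℕ} (u : Space d → ℝ) : Prop where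
  continuousOn : ContinuousOn u (Metric.ball 0 1)
  even : ∀ x ∈ Metric.ball (0 : Space d) 1, u (reflectLast x) = u x
  harmonic : InnerProductSpace.HarmonicOnNhd u (Metric.ball 0 1 \ contactSet u)
  nonneg : ∀ x ∈ Metric.ball (0 : Space d) 1 ∩ thinSpace d, 0 ≤ u x
  deriv_nonpos : ∀ x ∈ Metric.ball (0 : Space d) 1 ∩ thinSpace d,
    ∃ a : ℝ, a ≤ 0 ∧ HasDerivWithinAt (fun t : ℝ => u (x + t • eLast d)) a (Set.Ici 0) 0

/-- `u` is (positively) homogeneous of degree `μ`. -/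
def IsHomogeneous {d : ℕ} (μ : ℝ) (u : Space d → ℝ) : Prop :=
  ∀ r : ℝ, 0 < r → ∀ x : Space d, u (r • x) = r ^ μ * u x

end ThinObstacle

/-! Write x = (y, s), with s the last coordinate, and pair u(·, s) with the weights ⟪a, y⟫ᵏ
exp(-‖y‖²/2). Integrating Δ'u = -u_nn by parts against the Gaussian and using Euler's identity y·∇'u
+ s u_n = μ u gives, for the moments m_k on s > 0, m_k'' = s m_k' - (μ - k) m_k - k(k-1)‖a‖²
m_{k-2}: Hermite's equation with a source involving only a lower moment.

Consider m'' = s m' - ν m with m and m' of polynomial growth. If ν < 0, then (m m' exp(-s²/2))' =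
(m'² - ν m²) exp(-s²/2) ≥ 0, and this product tends to 0 at infinity, so m = 0 as soon as m(0) m'(0)
≥ 0. Differentiating the equation lowers ν by one and multiplies the product of the initial data by
-ν. Hence, for ν < K and ν ∉ {0, …, K-1}, the condition m(0) m'(0) ∏_{i<K} (i - ν) ≥ 0 forces m = 0
(`hermite_eq_zero`).

For k = 0, u ≥ 0 and u_n ≤ 0 on the thin space give m_0(0) ≥ 0 ≥ m_0'(0). If 2j < μ < 2j+1, the
product over i ≤ 2j has an odd number of negative factors, so m_0 = 0, and u ≥ 0 vanishes on the
thin space. Then every m_k(0) is 0, the sign condition is automatic, and since μ is not an integer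
an induction on k kills all moments. Gaussian moments determine u(·, s), so u = 0 for s ≥ 0, and
everywhere by evenness.

The sign of m_0'(0) requires a limit under the integral, while u_n exists only pointwise. A
one-sided Lipschitz bound supplies the domination; it comes from comparing u with its reflection by
means of a quadratic barrier (`neg_le_sub_of_reflection`). The same comparison yields the interior
derivative estimates. -/

namespace ThinObstacle

/-! ### Second derivatives along lines and pointwise Laplacians -/

open Set Filter Topology InnerProductSpace Laplacian

/-- `φ` is differentiable near `0` and its derivative has derivative `c` at `0`. -/
def HasSecondDeriv (φ : ℝ → ℝ) (c : ℝ) : Prop :=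
  ∃ g : ℝ → ℝ, (∀ᶠ t in 𝓝 0, HasDerivAt φ (g t) t) ∧ HasDerivAt g c 0

namespace HasSecondDeriv

variable {φ ψ : ℝ → ℝ} {c c' : ℝ}

theorem deriv_deriv (h : HasSecondDeriv φ c) : deriv (deriv φ) 0 = c := by
  obtain ⟨g, hg, hc⟩ := h
  have : deriv φ =ᶠ[𝓝 0] g := hg.mono fun t ht => ht.deriv
  rw [this.deriv_eq, hc.deriv]

theorem unique (h : HasSecondDeriv φ c) (h' : HasSecondDeriv φ c') : c = c' :=
  h.deriv_deriv.symm.trans h'.deriv_deriv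

theorem add (h : HasSecondDeriv φ c) (h' : HasSecondDeriv ψ c') :
    HasSecondDeriv (fun t => φ t + ψ t) (c + c') := by
  obtain ⟨g, hg, hc⟩ := h
  obtain ⟨g', hg', hc'⟩ := h'
  exact ⟨fun t => g t + g' t, by filter_upwards [hg, hg'] with t h1 h2 using h1.add h2, hc.add hc'⟩

theorem const_mul (a : ℝ) (h : HasSecondDeriv φ c) :
    HasSecondDeriv (fun t => a * φ t) (a * c) := by
  obtain ⟨g, hg, hc⟩ := h
  exact ⟨fun t => a * g t, by filter_upwards [hg] with t h1 using h1.const_mul a, hc.const_mul a⟩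

theorem congr (h : HasSecondDeriv φ c) (he : ψ =ᶠ[𝓝 0] φ) : HasSecondDeriv ψ c := by
  obtain ⟨g, hg, hc⟩ := h
  refine ⟨g, ?_, hc⟩
  filter_upwards [hg, he.eventually_nhds] with t h1 h2 using h1.congr_of_eventuallyEq h2

theorem quadratic (a b c : ℝ) : HasSecondDeriv (fun t => a + b * t + c * t ^ 2) (2 * c) := by
  refine ⟨fun t => b + 2 * c * t, .of_forall fun t => ?_, ?_⟩
  · have := ((hasDerivAt_id t).const_mul b).const_add a |>.add ((hasDerivAt_pow 2 t).const_mul c)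
    convert! this using 1
    simp; ring
  · have := ((hasDerivAt_id (0 : ℝ)).const_mul (2 * c)).const_add b
    convert! this using 1
    simp

/-- If `c < 0`, the second derivative test makes 0 a local maximum too, so `φ` is locally constant
and `c = 0`. -/
theorem nonneg_of_isLocalMin (h : HasSecondDeriv φ c) (hm : IsLocalMin φ 0) : 0 ≤ c := by
  by_contra! hc
  obtain ⟨g, hg, hgc⟩ := id h
  have hcont : ContinuousAt φ 0 := hg.self_of_nhds.continuousAt
  have hmax : IsLocalMax φ 0 :=
    isLocalMax_of_deriv_deriv_neg (by rw [h.deriv_deriv]; exact hc) hm.deriv_eq_zero hcont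
  have hconst : φ =ᶠ[𝓝 0] fun t => φ 0 + 0 * t + 0 * t ^ 2 := by
    filter_upwards [hm, hmax] with t h1 h2
    rw [le_antisymm h2 h1]; ring
  have := h.unique ((quadratic (φ 0) 0 0).congr hconst)
  linarith

end HasSecondDeriv

theorem nonneg_of_hasDerivWithinAt_Ici {φ : ℝ → ℝ} {c : ℝ}
    (h : HasDerivWithinAt φ c (Ici 0) 0) (hm : ∀ᶠ t in 𝓝[>] 0, φ 0 ≤ φ t) : 0 ≤ c := by
  have h1 : Tendsto (slope φ 0) (𝓝[>] 0) (𝓝 c) := by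
    have := hasDerivWithinAt_iff_tendsto_slope.1 h
    rwa [Ici_sdiff_left] at this
  refine ge_of_tendsto h1 ?_
  filter_upwards [hm, self_mem_nhdsWithin] with t h2 h3
  rw [slope_def_field]
  exact div_nonneg (by linarith) (by simpa using (mem_Ioi.1 h3).le)

section Euclidean

variable {E : Type*} [NormedAddCommGroup E] [InnerProductSpace ℝ E]

theorem hasDerivAt_line {f : E → ℝ} {x : E} (hf : DifferentiableAt ℝ f x) (v : E) :
    HasDerivAt (fun t : ℝ => f (x + t • v)) (fderiv ℝ f x v) 0 := by
  have h1 : HasDerivAt (fun t : ℝ => x + t • v) v 0 := by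
    simpa using ((hasDerivAt_id (0 : ℝ)).smul_const v).const_add x
  have h2 : HasFDerivAt f (fderiv ℝ f x) (x + (0 : ℝ) • v) := by simpa using hf.hasFDerivAt
  exact h2.comp_hasDerivAt 0 h1

theorem hasDerivAt_line' {f : E → ℝ} {x v : E} {t : ℝ} (hf : DifferentiableAt ℝ f (x + t • v)) :
    HasDerivAt (fun t : ℝ => f (x + t • v)) (fderiv ℝ f (x + t • v) v) t := by
  have h1 : HasDerivAt (fun t : ℝ => x + t • v) v t := by
    simpa using ((hasDerivAt_id t).smul_const v).const_add x
  exact hf.hasFDerivAt.comp_hasDerivAt t h1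

theorem differentiableAt_fderiv_apply {f : E → ℝ} {x : E} (hf : ContDiffAt ℝ 2 f x) (v : E) :
    DifferentiableAt ℝ (fun z => fderiv ℝ f z v) x := by
  have h : ContDiffAt ℝ 1 (fderiv ℝ f) x := hf.fderiv_right (by norm_num)
  exact (h.differentiableAt (by norm_num)).clm_apply (differentiableAt_const v)

theorem fderiv_fderiv_apply {f : E → ℝ} {x : E} (hf : ContDiffAt ℝ 2 f x) (v : E) :
    fderiv ℝ (fun z => fderiv ℝ f z v) x v = iteratedFDeriv ℝ 2 f x ![v, v] := by
  have h : ContDiffAt ℝ 1 (fderiv ℝ f) x := hf.fderiv_right (by norm_num)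
  rw [iteratedFDeriv_two_apply, fderiv_clm_apply (h.differentiableAt (by norm_num))
    (differentiableAt_const v)]
  simp

theorem hasSecondDeriv_line {f : E → ℝ} {x : E} (hf : ContDiffAt ℝ 2 f x) (v : E) :
    HasSecondDeriv (fun t : ℝ => f (x + t • v)) (iteratedFDeriv ℝ 2 f x ![v, v]) := by
  refine ⟨fun t => fderiv ℝ f (x + t • v) v, ?_, ?_⟩
  · have hc : Tendsto (fun t : ℝ => x + t • v) (𝓝 0) (𝓝 x) := by
      have : Continuous fun t : ℝ => x + t • v := by fun_prop
      simpa using this.tendsto 0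
    have := hc.eventually (hf.eventually (by simp))
    filter_upwards [this] with t ht
    exact hasDerivAt_line' (ht.differentiableAt (by norm_num))
  · rw [← fderiv_fderiv_apply hf]
    exact hasDerivAt_line (differentiableAt_fderiv_apply hf v) v

variable [FiniteDimensional ℝ E]

/-- `f` is twice continuously differentiable at `x` and its Laplacian vanishes there. -/
def LaplaceAt (f : E → ℝ) (x : E) : Prop := ContDiffAt ℝ 2 f x ∧ Δ f x = 0

theorem LaplaceAt.sum_eq_zero {ι : Type*} [Fintype ι] {f : E → ℝ} {x : E} (h : LaplaceAt f x)
    (b : OrthonormalBasis ι ℝ E) : ∑ i, iteratedFDeriv ℝ 2 f x ![b i, b i] = 0 := by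
  have := h.2
  rwa [laplacian_eq_iteratedFDeriv_orthonormalBasis f b] at this

theorem LaplaceAt.comp_smul_add {f : E → ℝ} {x a : E} {c : ℝ} (h : LaplaceAt f (c • x + a)) :
    LaplaceAt (fun z => f (c • z + a)) x := by
  have hcd : ContDiffAt ℝ 2 (fun z => f (c • z + a)) x :=
    ContDiffAt.comp x h.1 (by fun_prop)
  refine ⟨hcd, ?_⟩
  set b := stdOrthonormalBasis ℝ E
  rw [laplacian_eq_iteratedFDeriv_orthonormalBasis _ b]
  have key : ∀ v : E, iteratedFDeriv ℝ 2 (fun z => f (c • z + a)) x ![v, v]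
      = c ^ 2 * iteratedFDeriv ℝ 2 f (c • x + a) ![v, v] := by
    intro v
    have h1 := hasSecondDeriv_line hcd v
    have h2 := hasSecondDeriv_line h.1 (c • v)
    have h3 : (fun t : ℝ => f (c • (x + t • v) + a)) = fun t : ℝ => f (c • x + a + t • c • v) := by
      funext t; congr 1; simp only [smul_add, smul_smul]; rw [mul_comm c t]; abel
    rw [h3] at h1
    rw [h1.unique h2]
    have : (![c • v, c • v] : Fin 2 → E) = fun i => c • (![v, v] : Fin 2 → E) i := by
      funext i; fin_cases i <;> simp
    rw [this, (iteratedFDeriv ℝ 2 f (c • x + a)).map_smul_univ (fun _ => c)]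
    simp
  simp only [key, ← Finset.mul_sum, h.sum_eq_zero b, mul_zero]

theorem LaplaceAt.sub {f g : E → ℝ} {x : E} (hf : LaplaceAt f x) (hg : LaplaceAt g x) :
    LaplaceAt (fun z => f z - g z) x :=
  ⟨hf.1.sub hg.1, by
    have := hf.1.laplacian_sub hg.1
    rw [hf.2, hg.2, sub_zero] at this
    exact this⟩

theorem LaplaceAt.const_mul {f : E → ℝ} {x : E} (hf : LaplaceAt f x) (c : ℝ) :
    LaplaceAt (fun z => c * f z) x :=
  ⟨contDiffAt_const.mul hf.1, by
    have := laplacian_smul c hf.1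
    rw [hf.2, smul_zero] at this
    exact this⟩

end Euclidean

end ThinObstacle

namespace ThinObstacle

open Set Filter Topology InnerProductSpace Laplacian Metric

/-! ### Reflection comparison with a quadratic barrier -/

section Barrier

variable {E : Type*} [NormedAddCommGroup E] [InnerProductSpace ℝ E]

/-- The reflection in the hyperplane through `x₀` orthogonal to the unit vector `v`. -/
def hyperplaneReflection (x₀ v x : E) : E := x - (2 * inner ℝ (x - x₀) v) • v

/-- The quadratic barrier of the half ball `{‖x - x₀‖ < r, ⟪x - x₀, v⟫ > 0}`. -/
def barrier (K r : ℝ) (x₀ v x : E) : ℝ :=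
  ‖x - x₀‖ ^ 2 - K * inner ℝ (x - x₀) v ^ 2 + K * r * inner ℝ (x - x₀) v

theorem hyperplaneReflection_add (x₀ v x w : E) (t : ℝ) :
    hyperplaneReflection x₀ v (x + t • w) =
      hyperplaneReflection x₀ v x + t • (w - (2 * inner ℝ w v) • v) := by
  have : x + t • w - x₀ = (x - x₀) + t • w := by abel
  simp only [hyperplaneReflection, this, inner_add_left, real_inner_smul_left]
  module

theorem norm_hyperplaneReflection_sub {v : E} (hv : ‖v‖ = 1) (x₀ x : E) :
    ‖hyperplaneReflection x₀ v x - x₀‖ = ‖x - x₀‖ := by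
  have h : ‖hyperplaneReflection x₀ v x - x₀‖ ^ 2 = ‖x - x₀‖ ^ 2 := by
    have : hyperplaneReflection x₀ v x - x₀ = (x - x₀) - (2 * inner ℝ (x - x₀) v) • v := by
      simp only [hyperplaneReflection]; abel
    rw [this, norm_sub_sq_real, norm_smul, real_inner_smul_right, hv]
    simp only [Real.norm_eq_abs, mul_one, sq_abs]
    ring
  exact (sq_eq_sq₀ (norm_nonneg _) (norm_nonneg _)).1 h

theorem barrier_add (K r : ℝ) (x₀ v x w : E) (t : ℝ) :
    barrier K r x₀ v (x + t • w) = barrier K r x₀ v x +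
      (2 * inner ℝ (x - x₀) w - 2 * K * inner ℝ (x - x₀) v * inner ℝ w v
        + K * r * inner ℝ w v) * t + (‖w‖ ^ 2 - K * inner ℝ w v ^ 2) * t ^ 2 := by
  have : x + t • w - x₀ = (x - x₀) + t • w := by abel
  simp only [barrier, this, inner_add_left, real_inner_smul_left, norm_add_sq_real, norm_smul,
    real_inner_smul_right, mul_pow, Real.norm_eq_abs, sq_abs]
  ring

/-- The odd part of `U` under the reflection, corrected by the barrier and by a kink. -/
def oddPart (U : E → ℝ) (K r κ ε : ℝ) (x₀ v e x : E) : ℝ :=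
  U x - U (hyperplaneReflection x₀ v x) + κ * barrier K r x₀ v x - ε * |inner ℝ x e|

theorem hasDerivWithinAt_symmetric {U : E → ℝ} {x : E} (h : DifferentiableAt ℝ U x) (w : E) :
    HasDerivWithinAt (fun t : ℝ => U (x + t • w) + U (x - t • w)) 0 (Ici 0) 0 := by
  have h1 := hasDerivAt_line h w
  have h2 := hasDerivAt_line h (-w)
  have := (h1.add h2).hasDerivWithinAt (s := Ici 0)
  simp only [map_neg, add_neg_cancel, smul_neg, ← sub_eq_add_neg] at this
  exact this

variable [FiniteDimensional ℝ E]

/-- Off the crease the kink is locally linear and both copies of `U` have zero Laplacian, so the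
Laplacian of the odd part is 2κ(n - K) < 0, with n the dimension. -/
theorem not_isLocalMin_oddPart_of_ne {U : E → ℝ} {K r κ ε : ℝ} {x₀ v e x : E} (hv : ‖v‖ = 1)
    (hK : Module.finrank ℝ E < K) (hκ : 0 < κ) (hxe : inner ℝ x e ≠ 0) (hU : LaplaceAt U x)
    (hR : LaplaceAt U (hyperplaneReflection x₀ v x)) :
    ¬ IsLocalMin (oddPart U K r κ ε x₀ v e) x := by
  intro hmin
  set b := stdOrthonormalBasis ℝ E
  set ρ := (ℝ ∙ v)ᗮ.reflection
  have hρ : ∀ w, ρ w = w - (2 * inner ℝ w v) • v := by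
    intro w
    simp only [ρ, Submodule.reflection_orthogonal_apply, Submodule.reflection_singleton_apply, hv,
      real_inner_comm v w]
    simp; module
  -- Moving `x` along `b i` moves its mirror image along `b' i`; as `b'` is again orthonormal, the
  -- Laplacian at the mirror image can be computed in it.
  set b' := b.map ρ
  have hb' : ∀ i, b' i = b i - (2 * inner ℝ (b i) v) • v := fun i => by simp [b', hρ]
  obtain ⟨σ, hσ⟩ : ∃ σ : ℝ, ∀ᶠ z in 𝓝 x, |inner ℝ z e| = σ * inner ℝ z e := by
    have hc : ContinuousAt (fun z : E => inner ℝ z e) x := by fun_prop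
    rcases lt_or_gt_of_ne hxe with h | h
    · exact ⟨-1, (hc.eventually (gt_mem_nhds h)).mono fun z hz => by rw [abs_of_neg hz]; ring⟩
    · exact ⟨1, (hc.eventually (lt_mem_nhds h)).mono fun z hz => by rw [abs_of_pos hz]; ring⟩
  have hline : ∀ w : E, Tendsto (fun t : ℝ => x + t • w) (𝓝 0) (𝓝 x) := by
    intro w
    have : Continuous fun t : ℝ => x + t • w := by fun_prop
    simpa using this.tendsto 0
  have hsec : ∀ i, 0 ≤ iteratedFDeriv ℝ 2 U x ![b i, b i]
      + (-1) * iteratedFDeriv ℝ 2 U (hyperplaneReflection x₀ v x) ![b' i, b' i]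
      + 2 * (κ * (1 - K * inner ℝ (b i) v ^ 2)) := by
    intro i
    have h1 := (hasSecondDeriv_line hU.1 (b i)).add
      ((hasSecondDeriv_line hR.1 (b' i)).const_mul (-1))
    have h2 := HasSecondDeriv.quadratic (κ * barrier K r x₀ v x - ε * (σ * inner ℝ x e))
      (κ * (2 * inner ℝ (x - x₀) (b i) - 2 * K * inner ℝ (x - x₀) v * inner ℝ (b i) v
        + K * r * inner ℝ (b i) v) - ε * (σ * inner ℝ (b i) e))
      (κ * (1 - K * inner ℝ (b i) v ^ 2))
    refine ((h1.add h2).congr ?_).nonneg_of_isLocalMin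
      (φ := fun t : ℝ => oddPart U K r κ ε x₀ v e (x + t • b i)) ?_
    · filter_upwards [(hline (b i)).eventually hσ] with t ht
      rw [inner_add_left, real_inner_smul_left] at ht
      simp only [oddPart, ht, hyperplaneReflection_add, barrier_add, hb', inner_add_left,
        real_inner_smul_left, b.norm_eq_one]
      ring
    · have := (hline (b i)).eventually hmin
      filter_upwards [this] with t ht
      simpa using ht
  have hsum := Finset.sum_nonneg fun i (_ : i ∈ Finset.univ) => hsec i
  have hpars : ∑ i, inner ℝ (b i) v ^ 2 = 1 := by
    have := b.sum_sq_norm_inner_right v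
    simpa [hv] using this
  rw [Finset.sum_add_distrib, Finset.sum_add_distrib, ← Finset.mul_sum, hU.sum_eq_zero b,
    hR.sum_eq_zero b', ← Finset.mul_sum, ← Finset.mul_sum, Finset.sum_sub_distrib, ← Finset.mul_sum,
    hpars] at hsum
  simp at hsum
  nlinarith

/-- In the sum of the values at x ± te, the reflected term is differentiable and symmetric in t, the
linear part of the barrier cancels, and the kink contributes -2ε. The right derivative at 0 is thus
a - 2ε < 0; the kink is there to make this strict when a = 0. -/
theorem not_isLocalMin_oddPart_of_eq {U : E → ℝ} {K r κ ε a : ℝ} {x₀ v e x : E} (he : ‖e‖ = 1)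
    (hε : 0 < ε) (hxe : inner ℝ x e = 0) (ha : a ≤ 0)
    (hU : HasDerivWithinAt (fun t : ℝ => U (x + t • e) + U (x - t • e)) a (Ici 0) 0)
    (hR : LaplaceAt U (hyperplaneReflection x₀ v x)) :
    ¬ IsLocalMin (oddPart U K r κ ε x₀ v e) x := by
  intro hmin
  set w := e - (2 * inner ℝ e v) • v
  have h1 := hasDerivWithinAt_symmetric (hR.1.differentiableAt (by norm_num)) w
  have h2 : HasDerivWithinAt (fun t : ℝ => 2 * κ * barrier K r x₀ v x - 2 * ε * t
      + 2 * κ * (‖e‖ ^ 2 - K * inner ℝ e v ^ 2) * t ^ 2) (-2 * ε) (Ici 0) 0 := by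
    have := (((hasDerivAt_id (0 : ℝ)).const_mul (2 * ε)).const_sub (2 * κ * barrier K r x₀ v x)).add
      ((hasDerivAt_pow 2 (0 : ℝ)).const_mul (2 * κ * (‖e‖ ^ 2 - K * inner ℝ e v ^ 2)))
    refine (this.hasDerivWithinAt).congr_deriv ?_
    simp
  have h3 := (hU.sub h1).add h2
  have hF : ∀ t : ℝ, 0 ≤ t → oddPart U K r κ ε x₀ v e (x + t • e)
      + oddPart U K r κ ε x₀ v e (x + (-t) • e) =
      U (x + t • e) + U (x - t • e) - (U (hyperplaneReflection x₀ v x + t • w)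
        + U (hyperplaneReflection x₀ v x - t • w)) + (2 * κ * barrier K r x₀ v x - 2 * ε * t
      + 2 * κ * (‖e‖ ^ 2 - K * inner ℝ e v ^ 2) * t ^ 2) := by
    intro t ht
    simp only [oddPart, hyperplaneReflection_add, barrier_add, inner_add_left,
        real_inner_smul_left, hxe, real_inner_self_eq_norm_sq, he]
    simp only [neg_smul, ← sub_eq_add_neg, w]
    rw [zero_add, zero_add, one_pow, mul_one, mul_one, abs_neg, abs_of_nonneg ht]
    ring
  have := nonneg_of_hasDerivWithinAt_Ici h3 ?_
  · linarith
  · have hline : Tendsto (fun t : ℝ => x + t • e) (𝓝 0) (𝓝 x) := by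
      have : Continuous fun t : ℝ => x + t • e := by fun_prop
      simpa using this.tendsto 0
    have hline' : Tendsto (fun t : ℝ => x + (-t) • e) (𝓝 0) (𝓝 x) := by
      have : Continuous fun t : ℝ => x + (-t) • e := by fun_prop
      simpa using this.tendsto 0
    filter_upwards [(hline.eventually hmin).filter_mono nhdsWithin_le_nhds,
      (hline'.eventually hmin).filter_mono nhdsWithin_le_nhds, self_mem_nhdsWithin] with t h4 h5 h6
    have e0 := hF 0 le_rfl
    have et := hF t (le_of_lt h6)
    simp only [Pi.add_apply, Pi.sub_apply]
    rw [← e0, ← et]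
    simp only [zero_smul, neg_zero, add_zero]
    linarith

/-- A function which is superharmonic on one half of a ball and harmonic on the other half is
one-sidedly Lipschitz across the separating hyperplane. -/
theorem neg_le_sub_of_reflection {U : E → ℝ} {x₀ v e : E} {r M : ℝ} (hr : 0 < r) (hM0 : 0 < M)
    (hv : ‖v‖ = 1) (he : ‖e‖ = 1) (hM : ∀ x ∈ closedBall x₀ r, |U x| ≤ M)
    (hc : ContinuousOn U (closedBall x₀ r))
    (hne : ∀ x ∈ ball x₀ r, 0 < inner ℝ (x - x₀) v → inner ℝ x e ≠ 0 → LaplaceAt U x)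
    (heq : ∀ x ∈ ball x₀ r, 0 < inner ℝ (x - x₀) v → inner ℝ x e = 0 →
      ∃ a ≤ 0, HasDerivWithinAt (fun t : ℝ => U (x + t • e) + U (x - t • e)) a (Ici 0) 0)
    (hR : ∀ x ∈ ball x₀ r, 0 < inner ℝ (x - x₀) v → LaplaceAt U (hyperplaneReflection x₀ v x))
    {t : ℝ} (ht : t ∈ Icc 0 r) :
    -(2 * M * (Module.finrank ℝ E + 1) / r * t) ≤ U (x₀ + t • v) - U (x₀ - t • v) := by
  -- Exceeding the dimension makes the barrier strictly superharmonic.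
  set K : ℝ := Module.finrank ℝ E + 1 with hK
  have hKpos : 0 < K := by positivity
  -- On the spherical part of the boundary the barrier is at least r², so κr² = 2M absorbs the
  -- difference of the two values of `U`.
  set κ : ℝ := 2 * M / r ^ 2 with hκ
  have hκpos : 0 < κ := by positivity
  set S : ℝ := ‖x₀‖ + r
  set A : Set E := closedBall x₀ r ∩ {x | 0 ≤ inner ℝ (x - x₀) v}
  have hAc : IsCompact A := (isCompact_closedBall x₀ r).inter_right
    (isClosed_le continuous_const (by fun_prop))
  have hRA : MapsTo (hyperplaneReflection x₀ v) A (closedBall x₀ r) := by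
    intro x hx
    rw [mem_closedBall, dist_eq_norm, norm_hyperplaneReflection_sub hv, ← dist_eq_norm]
    exact hx.1
  have hτ : ∀ x ∈ closedBall x₀ r, inner ℝ (x - x₀) v ≤ r := by
    intro x hx
    calc inner ℝ (x - x₀) v ≤ ‖x - x₀‖ * ‖v‖ := real_inner_le_norm _ _
      _ ≤ r := by rw [hv, mul_one, ← dist_eq_norm]; exact hx
  have hS : ∀ x ∈ A, |inner ℝ x e| ≤ S := by
    intro x hx
    calc |inner ℝ x e| ≤ ‖x‖ * ‖e‖ := abs_real_inner_le_norm _ _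
      _ ≤ S := by
        rw [he, mul_one]
        calc ‖x‖ = ‖x₀ + (x - x₀)‖ := by congr 1; abel
          _ ≤ ‖x₀‖ + ‖x - x₀‖ := norm_add_le _ _
          _ ≤ S := by
            have := mem_closedBall.1 hx.1
            rw [dist_eq_norm] at this
            simp only [S]; linarith
  have hmain : ∀ ε > 0, ∀ x ∈ A, -(ε * S) ≤ oddPart U K r κ ε x₀ v e x := by
    intro ε hε
    have hcont : ContinuousOn (oddPart U K r κ ε x₀ v e) A := by
      have h1 : ContinuousOn U A := hc.mono inter_subset_left
      have h2 : ContinuousOn (fun x => U (hyperplaneReflection x₀ v x)) A :=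
        hc.comp (by unfold hyperplaneReflection; fun_prop) hRA
      have h3 : ContinuousOn (fun x => barrier K r x₀ v x) A := by
        unfold barrier; fun_prop
      unfold oddPart
      exact ((h1.sub h2).add (continuousOn_const.mul h3)).sub (by fun_prop)
    have hAne : A.Nonempty := ⟨x₀, by simp [A, hr.le]⟩
    obtain ⟨x, hxA, hxmin⟩ := hAc.exists_isMinOn hAne hcont
    suffices h : -(ε * S) ≤ oddPart U K r κ ε x₀ v e x from
      fun y hy => h.trans (hxmin hy)
    have hεS : ε * |inner ℝ x e| ≤ ε * S := mul_le_mul_of_nonneg_left (hS x hxA) hε.le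
    -- Where can the minimum lie? On the flat face the two copies of `U` cancel, the interior is
    -- excluded by the two preceding lemmas, and on the sphere the barrier wins.
    by_cases h0 : inner ℝ (x - x₀) v = 0
    · have h1 : hyperplaneReflection x₀ v x = x := by simp [hyperplaneReflection, h0]
      have h2 : 0 ≤ barrier K r x₀ v x := by simp only [barrier, h0]; nlinarith [sq_nonneg ‖x - x₀‖]
      unfold oddPart
      rw [h1]
      nlinarith [mul_nonneg hκpos.le h2]
    have hpos : 0 < inner ℝ (x - x₀) v := lt_of_le_of_ne hxA.2 (Ne.symm h0)
    by_cases hxb : x ∈ ball x₀ r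
    · exfalso
      have hloc : IsLocalMin (oddPart U K r κ ε x₀ v e) x := by
        refine hxmin.isLocalMin ?_
        have h1 : ∀ᶠ z in 𝓝 x, z ∈ ball x₀ r := isOpen_ball.mem_nhds hxb
        have h2 : ∀ᶠ z in 𝓝 x, 0 < inner ℝ (z - x₀) v :=
          (show ContinuousAt (fun z => inner ℝ (z - x₀) v) x by fun_prop).eventually
            (lt_mem_nhds hpos)
        filter_upwards [h1, h2] with z hz1 hz2
        exact ⟨ball_subset_closedBall hz1, hz2.le⟩
      by_cases hxe : inner ℝ x e = 0
      · obtain ⟨a, ha, hd⟩ := heq x hxb hpos hxe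
        exact not_isLocalMin_oddPart_of_eq he hε hxe ha hd (hR x hxb hpos) hloc
      · exact not_isLocalMin_oddPart_of_ne hv (by simp [hK]) hκpos hxe (hne x hxb hpos hxe)
          (hR x hxb hpos) hloc
    · have hxr : ‖x - x₀‖ = r := by
        have h1 := mem_closedBall.1 hxA.1
        have h2 : ¬ dist x x₀ < r := fun h => hxb h
        rw [← dist_eq_norm]; linarith
      have h1 : r ^ 2 ≤ barrier K r x₀ v x := by
        have := hτ x hxA.1
        simp only [barrier, hxr]
        nlinarith [mul_nonneg (mul_nonneg hKpos.le hpos.le) (sub_nonneg.2 this)]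
      have h2 := abs_le.1 (hM x hxA.1)
      have h3 := abs_le.1 (hM _ (hRA hxA))
      have h4 : 2 * M ≤ κ * barrier K r x₀ v x := by
        calc 2 * M = κ * r ^ 2 := by rw [hκ]; field_simp
          _ ≤ _ := mul_le_mul_of_nonneg_left h1 hκpos.le
      unfold oddPart
      linarith
  have hxt : x₀ + t • v - x₀ = t • v := by abel
  have hin : inner ℝ (x₀ + t • v - x₀) v = t := by
    rw [hxt, real_inner_smul_left, real_inner_self_eq_norm_sq, hv]; ring
  have hA : x₀ + t • v ∈ A := by
    refine ⟨?_, ?_⟩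
    · rw [mem_closedBall, dist_eq_norm, hxt, norm_smul, hv, mul_one, Real.norm_eq_abs,
        abs_of_nonneg ht.1]
      exact ht.2
    · change 0 ≤ inner ℝ (x₀ + t • v - x₀) v
      rw [hin]; exact ht.1
  have hlim : 0 ≤ U (x₀ + t • v) - U (hyperplaneReflection x₀ v (x₀ + t • v))
      + κ * barrier K r x₀ v (x₀ + t • v) := by
    have hSpos : 0 < S := by positivity
    -- Let the kink disappear, with ε = δ / S.
    refine le_of_forall_pos_le_add fun δ hδ => ?_
    have := hmain (δ / S) (by positivity) _ hA
    unfold oddPart at this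
    rw [div_mul_cancel₀ _ hSpos.ne'] at this
    have h2 : 0 ≤ δ / S * |inner ℝ (x₀ + t • v) e| := by positivity
    linarith
  have hrefl : hyperplaneReflection x₀ v (x₀ + t • v) = x₀ - t • v := by
    unfold hyperplaneReflection
    rw [hin]; module
  have hbar : κ * barrier K r x₀ v (x₀ + t • v) ≤ 2 * M * K / r * t := by
    have h1 : barrier K r x₀ v (x₀ + t • v) ≤ K * r * t := by
      unfold barrier
      rw [hin, hxt, norm_smul, hv, mul_one, Real.norm_eq_abs, sq_abs]
      have : (1 : ℝ) ≤ K := by simp [hK]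
      nlinarith [sq_nonneg t]
    calc κ * barrier K r x₀ v (x₀ + t • v) ≤ κ * (K * r * t) :=
          mul_le_mul_of_nonneg_left h1 hκpos.le
      _ = 2 * M * K / r * t := by rw [hκ]; field_simp
  rw [hrefl] at hlim
  linarith

end Barrier

end ThinObstacle

namespace ThinObstacle

open Set Filter Topology InnerProductSpace Laplacian Metric

/-! ### Interior derivative estimates -/

section Interior

variable {E : Type*} [NormedAddCommGroup E] [InnerProductSpace ℝ E] [FiniteDimensional ℝ E]

/-- The one-sided comparison is applied to `v` and to `-v`. Since `U` is smooth, the crease may be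
placed anywhere: the symmetric derivative there is 0. -/
theorem abs_sub_le_of_laplaceAt {U : E → ℝ} {x₀ v : E} {r M : ℝ} (hr : 0 < r) (hM0 : 0 < M)
    (hv : ‖v‖ = 1) (hM : ∀ x ∈ closedBall x₀ r, |U x| ≤ M)
    (hU : ∀ x ∈ closedBall x₀ r, LaplaceAt U x) {t : ℝ} (ht : t ∈ Icc 0 r) :
    |U (x₀ + t • v) - U (x₀ - t • v)| ≤ 2 * M * (Module.finrank ℝ E + 1) / r * t := by
  have key : ∀ w : E, ‖w‖ = 1 →
      -(2 * M * (Module.finrank ℝ E + 1) / r * t) ≤ U (x₀ + t • w) - U (x₀ - t • w) := by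
    intro w hw
    refine neg_le_sub_of_reflection hr hM0 hw hw hM
      (fun x hx => (hU x hx).1.continuousAt.continuousWithinAt)
      (fun x hx _ _ => hU x (ball_subset_closedBall hx))
      (fun x hx _ _ => ⟨0, le_rfl, hasDerivWithinAt_symmetric
        ((hU x (ball_subset_closedBall hx)).1.differentiableAt (by norm_num)) w⟩)
      (fun x hx _ => hU _ ?_) ht
    rw [mem_closedBall, dist_eq_norm, norm_hyperplaneReflection_sub hw, ← dist_eq_norm]
    exact (mem_ball.1 hx).le
  have h1 := key v hv
  have h2 := key (-v) (by rwa [norm_neg])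
  simp only [smul_neg, sub_neg_eq_add, ← sub_eq_add_neg] at h2
  rw [abs_le]
  constructor <;> linarith

theorem abs_le_of_hasDerivAt_of_abs_le {φ : ℝ → ℝ} {c K r : ℝ} (h : HasDerivAt φ c 0) (hr : 0 < r)
    (h0 : φ 0 = 0) (hK : ∀ t ∈ Ioc 0 r, |φ t| ≤ K * t) : |c| ≤ K := by
  have h1 : Tendsto (slope φ 0) (𝓝[>] 0) (𝓝 c) :=
    (hasDerivAt_iff_tendsto_slope.1 h).mono_left (nhdsWithin_mono _ fun t ht => (ne_of_gt ht))
  refine le_of_tendsto h1.abs ?_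
  filter_upwards [Ioc_mem_nhdsGT hr] with t ht
  rw [slope_def_field, h0, sub_zero, sub_zero, abs_div, abs_of_pos ht.1, div_le_iff₀ ht.1]
  exact hK t ht

theorem abs_fderiv_le_of_laplaceAt {U : E → ℝ} {x₀ v : E} {r M : ℝ} (hr : 0 < r) (hM0 : 0 < M)
    (hv : ‖v‖ = 1) (hM : ∀ x ∈ closedBall x₀ r, |U x| ≤ M)
    (hU : ∀ x ∈ closedBall x₀ r, LaplaceAt U x) :
    |fderiv ℝ U x₀ v| ≤ M * (Module.finrank ℝ E + 1) / r := by
  have hd := (hU x₀ (mem_closedBall_self hr.le)).1.differentiableAt (by norm_num)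
  have h1 := hasDerivAt_line hd v
  have h2 := hasDerivAt_line hd (-v)
  have h3 := h1.sub h2
  simp only [map_neg, smul_neg, ← sub_eq_add_neg, sub_neg_eq_add] at h3
  have h4 := abs_le_of_hasDerivAt_of_abs_le h3 hr (by simp) fun t ht =>
    abs_sub_le_of_laplaceAt hr hM0 hv hM hU ⟨ht.1.le, ht.2⟩
  rw [← two_mul, abs_mul, abs_two] at h4
  calc |fderiv ℝ U x₀ v| ≤ (2 * M * (Module.finrank ℝ E + 1) / r) / 2 := by linarith
    _ = _ := by ring

/-- The difference of the translates of `U` by ±tv is harmonic and O(t) on the half-size ball, so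
the gradient bound applied to it is O(t) as well; dividing by 2t and letting t → 0 gives the claim.
-/
theorem abs_iteratedFDeriv_le_of_laplaceAt {U : E → ℝ} {x₀ v : E} {r M : ℝ} (hr : 0 < r)
    (hM0 : 0 < M) (hv : ‖v‖ = 1) (hM : ∀ x ∈ closedBall x₀ r, |U x| ≤ M)
    (hU : ∀ x ∈ closedBall x₀ r, LaplaceAt U x) :
    |iteratedFDeriv ℝ 2 U x₀ ![v, v]| ≤ 4 * M * (Module.finrank ℝ E + 1) ^ 2 / r ^ 2 := by
  have hx₀ := (hU x₀ (mem_closedBall_self hr.le)).1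
  have hd := differentiableAt_fderiv_apply hx₀ v
  have h1 := hasDerivAt_line hd v
  have h2 := hasDerivAt_line hd (-v)
  have h3 := h1.sub h2
  simp only [map_neg, smul_neg, ← sub_eq_add_neg, sub_neg_eq_add, fderiv_fderiv_apply hx₀] at h3
  have hr2 : 0 < r / 2 := by positivity
  have hsub : ∀ x ∈ closedBall x₀ (r / 2), closedBall x (r / 2) ⊆ closedBall x₀ r := by
    intro x hx
    refine closedBall_subset_closedBall' ?_
    have := mem_closedBall.1 hx
    linarith
  have hmem : ∀ x ∈ closedBall x₀ (r / 2), ∀ s : ℝ, |s| ≤ r / 2 → x + s • v ∈ closedBall x₀ r := by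
    intro x hx s hs
    refine hsub x hx ?_
    rw [mem_closedBall, dist_eq_norm, add_sub_cancel_left, norm_smul, hv, mul_one, Real.norm_eq_abs]
    exact hs
  have h4 := abs_le_of_hasDerivAt_of_abs_le (K := 8 * M * (Module.finrank ℝ E + 1) ^ 2 / r ^ 2)
    h3 hr2 (by simp) ?_
  · rw [← two_mul, abs_mul, abs_two] at h4
    calc |iteratedFDeriv ℝ 2 U x₀ ![v, v]|
        ≤ (8 * M * (Module.finrank ℝ E + 1) ^ 2 / r ^ 2) / 2 := by linarith
      _ = _ := by ring
  · intro t ht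
    have habs : |t| ≤ r / 2 := by rw [abs_of_pos ht.1]; exact ht.2
    have habs' : |-t| ≤ r / 2 := by rwa [abs_neg]
    set w : E → ℝ := fun x => U (x + t • v) - U (x + (-t) • v) with hw
    have hwL : ∀ x ∈ closedBall x₀ (r / 2), LaplaceAt w x := by
      intro x hx
      have h1 : LaplaceAt (fun z => U ((1 : ℝ) • z + t • v)) x :=
        LaplaceAt.comp_smul_add (by rw [one_smul]; exact hU _ (hmem x hx t habs))
      have h2 : LaplaceAt (fun z => U ((1 : ℝ) • z + (-t) • v)) x :=
        LaplaceAt.comp_smul_add (by rw [one_smul]; exact hU _ (hmem x hx (-t) habs'))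
      simpa only [one_smul] using h1.sub h2
    have hwM : ∀ x ∈ closedBall x₀ (r / 2),
        |w x| ≤ 2 * M * (Module.finrank ℝ E + 1) / (r / 2) * t := by
      intro x hx
      have := abs_sub_le_of_laplaceAt hr2 hM0 hv (fun z hz => hM z (hsub x hx hz))
        (fun z hz => hU z (hsub x hx hz)) ⟨ht.1.le, ht.2⟩
      simpa only [hw, neg_smul, ← sub_eq_add_neg] using this
    have hpos : 0 < 2 * M * (Module.finrank ℝ E + 1) / (r / 2) * t := by
      have := ht.1
      positivity
    have h5 := abs_fderiv_le_of_laplaceAt hr2 hpos hv hwM hwL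
    have hx0 : x₀ ∈ closedBall x₀ (r / 2) := mem_closedBall_self hr2.le
    have h6 : fderiv ℝ w x₀ v = fderiv ℝ U (x₀ + t • v) v - fderiv ℝ U (x₀ - t • v) v := by
      have e1 := (hU _ (hmem x₀ hx0 t habs)).1.differentiableAt (by norm_num)
      have e2 := (hU _ (hmem x₀ hx0 (-t) habs')).1.differentiableAt (by norm_num)
      have e3 : HasFDerivAt w (fderiv ℝ U (x₀ + t • v) - fderiv ℝ U (x₀ + (-t) • v)) x₀ :=
        ((hasFDerivAt_comp_add_right (t • v)).2 e1.hasFDerivAt).sub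
        ((hasFDerivAt_comp_add_right ((-t) • v)).2 e2.hasFDerivAt)
      rw [e3.fderiv, neg_smul, ← sub_eq_add_neg]
      rfl
    rw [h6] at h5
    calc _ ≤ _ := h5
      _ = _ := by field_simp; ring

end Interior

/-! ### Extension to the whole space by homogeneity -/

section Entire

variable {d : ℕ}

/-- A homogeneous solution of the thin obstacle problem in the whole space. -/
structure IsEntireSolution (μ : ℝ) (u : Space d → ℝ) : Prop where
  continuous : Continuous u
  even : ∀ x, u (reflectLast x) = u x
  laplace : ∀ x : Space d, x (Fin.last d) ≠ 0 → LaplaceAt u x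
  nonneg : ∀ x ∈ thinSpace d, 0 ≤ u x
  deriv_nonpos : ∀ x ∈ thinSpace d,
    ∃ a : ℝ, a ≤ 0 ∧ HasDerivWithinAt (fun t : ℝ => u (x + t • eLast d)) a (Ici 0) 0
  homogeneous : IsHomogeneous μ u

theorem reflectLast_smul (c : ℝ) (x : Space d) : reflectLast (c • x) = c • reflectLast x := by
  simp only [reflectLast, PiLp.smul_apply, smul_eq_mul]
  module

theorem exists_scale (x : Space d) : ∃ R : ℝ, 0 < R ∧ R⁻¹ • x ∈ ball (0 : Space d) 1 := by
  refine ⟨‖x‖ + 1, by positivity, ?_⟩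
  rw [mem_ball_zero_iff, norm_smul, norm_inv, Real.norm_of_nonneg (by positivity : 0 ≤ ‖x‖ + 1),
    inv_mul_lt_iff₀ (by positivity)]
  linarith

theorem IsHomogeneous.eq_scale {μ : ℝ} {u : Space d → ℝ} (h : IsHomogeneous μ u) {R : ℝ}
    (hR : 0 < R) (z : Space d) : u z = R ^ μ * u (R⁻¹ • z) := by
  rw [← h R hR, smul_inv_smul₀ hR.ne']

theorem IsSolution.isEntireSolution {μ : ℝ} {u : Space d → ℝ} (hu : IsSolution u)
    (h : IsHomogeneous μ u) : IsEntireSolution μ u where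
  homogeneous := h
  continuous := by
    rw [continuous_iff_continuousAt]
    intro x
    obtain ⟨R, hR, hx⟩ := exists_scale x
    have h1 : u = fun z => R ^ μ * u (R⁻¹ • z) := funext (h.eq_scale hR)
    rw [h1]
    have h2 : ContinuousAt u (R⁻¹ • x) := hu.continuousOn.continuousAt (isOpen_ball.mem_nhds hx)
    exact continuousAt_const.mul (h2.comp (f := fun z : Space d => R⁻¹ • z) (by fun_prop))
  even := by
    intro x
    obtain ⟨R, hR, hx⟩ := exists_scale x
    rw [h.eq_scale hR x, h.eq_scale hR (reflectLast x), ← reflectLast_smul, hu.even _ hx]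
  laplace := by
    intro x hx0
    obtain ⟨R, hR, hx⟩ := exists_scale x
    have h1 : u = fun z => R ^ μ * u (R⁻¹ • z + 0) := funext fun z => by
      rw [add_zero]; exact h.eq_scale hR z
    rw [h1]
    refine (LaplaceAt.comp_smul_add ?_).const_mul _
    have h2 := hu.harmonic (R⁻¹ • x) ⟨hx, fun hc => ?_⟩
    · rw [add_zero]
      exact ⟨h2.1, h2.2.eq_of_nhds⟩
    · have : (R⁻¹ • x : Space d) (Fin.last d) = 0 := hc.1
      simp only [PiLp.smul_apply, smul_eq_mul, mul_eq_zero, inv_eq_zero] at this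
      exact this.elim hR.ne' hx0
  nonneg := by
    intro x hx0
    obtain ⟨R, hR, hx⟩ := exists_scale x
    rw [h.eq_scale hR x]
    refine mul_nonneg (Real.rpow_nonneg hR.le _) (hu.nonneg _ ⟨hx, ?_⟩)
    have : x (Fin.last d) = 0 := hx0
    simp [thinSpace, this]
  deriv_nonpos := by
    intro x hx0
    obtain ⟨R, hR, hx⟩ := exists_scale x
    obtain ⟨a, ha, hd⟩ := hu.deriv_nonpos (R⁻¹ • x) ⟨hx, by
      have : x (Fin.last d) = 0 := hx0
      simp [thinSpace, this]⟩
    refine ⟨R ^ μ * (a * R⁻¹), mul_nonpos_of_nonneg_of_nonpos (Real.rpow_nonneg hR.le _)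
      (mul_nonpos_of_nonpos_of_nonneg ha (inv_nonneg.2 hR.le)), ?_⟩
    have h1 : HasDerivWithinAt (fun t : ℝ => t * R⁻¹) R⁻¹ (Ici 0) 0 := by
      simpa using ((hasDerivAt_id (0 : ℝ)).mul_const R⁻¹).hasDerivWithinAt
    have hd' : HasDerivWithinAt (fun t : ℝ => u (R⁻¹ • x + t • eLast d)) a (Ici 0) (0 * R⁻¹) := by
      rwa [zero_mul]
    have h2 := (hd'.scomp (0 : ℝ) h1 fun t ht => mul_nonneg ht (inv_nonneg.2 hR.le)).const_mul
      (R ^ μ)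
    have h3 : (fun t : ℝ => u (x + t • eLast d)) = fun t : ℝ => R ^ μ *
        ((fun t : ℝ => u (R⁻¹ • x + t • eLast d)) ∘ fun t => t * R⁻¹) t := by
      funext t
      rw [h.eq_scale hR (x + t • eLast d), smul_add, smul_smul, Function.comp_apply, mul_comm t]
    rw [h3]
    refine h2.congr_deriv ?_
    simp [mul_comm]

/-- Rescaling by 1 + ‖x‖ lands in the unit ball. As this factor is at least 1, any natural number N
≥ μ will do, also for negative μ. -/
theorem IsEntireSolution.exists_growth {μ : ℝ} {u : Space d → ℝ} (hu : IsEntireSolution μ u) :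
    ∃ C : ℝ, 0 < C ∧ ∃ N : ℕ, ∀ x, |u x| ≤ C * (1 + ‖x‖) ^ N := by
  obtain ⟨N, hN⟩ := exists_nat_ge μ
  obtain ⟨C, hC⟩ := (isCompact_closedBall (0 : Space d) 1).exists_bound_of_continuousOn
    hu.continuous.continuousOn
  have hC0 : 0 ≤ C := (norm_nonneg _).trans (hC 0 (by simp))
  refine ⟨C + 1, by positivity, N, fun x => ?_⟩
  have hR : 1 ≤ 1 + ‖x‖ := by linarith [norm_nonneg x]
  have hR0 : 0 < 1 + ‖x‖ := by linarith
  have h1 : (1 + ‖x‖)⁻¹ • x ∈ closedBall (0 : Space d) 1 := by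
    rw [mem_closedBall_zero_iff, norm_smul, norm_inv, Real.norm_of_nonneg hR0.le,
      inv_mul_le_iff₀ hR0]
    linarith
  rw [hu.homogeneous.eq_scale hR0 x, abs_mul, abs_of_nonneg (Real.rpow_nonneg hR0.le _), mul_comm]
  have h2 : (1 + ‖x‖) ^ μ ≤ (1 + ‖x‖) ^ N := by
    rw [← Real.rpow_natCast]
    exact Real.rpow_le_rpow_of_exponent_le hR hN
  refine mul_le_mul ((hC _ h1).trans (by linarith)) h2 (Real.rpow_nonneg hR0.le _) (by positivity)

end Entire

end ThinObstacle

namespace ThinObstacle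

open Set Filter Topology

/-! ### Hermite's equation on the half line -/

section Hermite

/-- Polynomial growth at `+∞`. -/
def PolyGrowth (f : ℝ → ℝ) : Prop := ∃ C : ℝ, ∃ N : ℕ, ∀ s : ℝ, 1 ≤ s → |f s| ≤ C * s ^ N

theorem PolyGrowth.mul {f g : ℝ → ℝ} (hf : PolyGrowth f) (hg : PolyGrowth g) :
    PolyGrowth fun s => f s * g s := by
  obtain ⟨C, N, h⟩ := hf
  obtain ⟨C', N', h'⟩ := hg
  refine ⟨C * C', N + N', fun s hs => ?_⟩
  rw [abs_mul]
  calc |f s| * |g s| ≤ (C * s ^ N) * (C' * s ^ N') :=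
        mul_le_mul (h s hs) (h' s hs) (abs_nonneg _) ((abs_nonneg _).trans (h s hs))
    _ = _ := by ring

theorem PolyGrowth.sub {f g : ℝ → ℝ} (hf : PolyGrowth f) (hg : PolyGrowth g) :
    PolyGrowth fun s => f s - g s := by
  obtain ⟨C, N, h⟩ := hf
  obtain ⟨C', N', h'⟩ := hg
  refine ⟨|C| + |C'|, N + N', fun s hs => ?_⟩
  have h1 : C * s ^ N ≤ |C| * s ^ (N + N') :=
    mul_le_mul (le_abs_self C) (pow_le_pow_right₀ hs (by omega)) (by positivity) (abs_nonneg _)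
  have h2 : C' * s ^ N' ≤ |C'| * s ^ (N + N') :=
    mul_le_mul (le_abs_self C') (pow_le_pow_right₀ hs (by omega)) (by positivity) (abs_nonneg _)
  calc |f s - g s| ≤ |f s| + |g s| := abs_sub _ _
    _ ≤ _ := by rw [add_mul]; linarith [h s hs, h' s hs]

theorem polyGrowth_id : PolyGrowth fun s => s :=
  ⟨1, 1, fun s hs => by rw [abs_of_nonneg (by linarith)]; simp⟩

theorem polyGrowth_const (c : ℝ) : PolyGrowth fun _ => c :=
  ⟨|c|, 0, fun s hs => by simp⟩

theorem PolyGrowth.tendsto_mul_exp {f : ℝ → ℝ} (hf : PolyGrowth f) :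
    Tendsto (fun s => f s * Real.exp (-s ^ 2 / 2)) atTop (𝓝 0) := by
  obtain ⟨C, N, h⟩ := hf
  have h1 : Tendsto (fun s : ℝ => C * (s ^ N * Real.exp (-s))) atTop (𝓝 0) := by
    simpa using (Real.tendsto_pow_mul_exp_neg_atTop_nhds_zero N).const_mul C
  refine squeeze_zero_norm' ?_ h1
  filter_upwards [eventually_ge_atTop 2] with s hs
  rw [norm_mul, Real.norm_eq_abs, Real.norm_eq_abs, Real.abs_exp, ← mul_assoc]
  refine mul_le_mul (h s (by linarith)) (Real.exp_le_exp.2 (by nlinarith)) (Real.exp_pos _).le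
    ((abs_nonneg _).trans (h s (by linarith)))

/-- The function m p exp(-s²/2) is nondecreasing, starts nonnegative and tends to 0, so it vanishes;
then so does its derivative, in which both terms are nonnegative. -/
theorem hermite_eq_zero_of_neg {ν m₀ p₀ : ℝ} {m p : ℝ → ℝ} (hm : ∀ s > 0, HasDerivAt m (p s) s)
    (hp : ∀ s > 0, HasDerivAt p (s * p s - ν * m s) s) (hm₀ : Tendsto m (𝓝[>] 0) (𝓝 m₀))
    (hp₀ : Tendsto p (𝓝[>] 0) (𝓝 p₀)) (gm : PolyGrowth m) (gp : PolyGrowth p) (hν : ν < 0)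
    (h0 : 0 ≤ m₀ * p₀) : ∀ s > 0, m s = 0 := by
  set Q : ℝ → ℝ := fun s => m s * p s * Real.exp (-s ^ 2 / 2) with hQ
  have hQd : ∀ s > 0, HasDerivAt Q ((p s ^ 2 - ν * m s ^ 2) * Real.exp (-s ^ 2 / 2)) s := by
    intro s hs
    have h1 : HasDerivAt (fun s : ℝ => Real.exp (-s ^ 2 / 2)) (Real.exp (-s ^ 2 / 2) * (-s)) s := by
      have := (((hasDerivAt_pow 2 s).neg).div_const 2).exp
      convert! this using 1
      simp
      ring
    convert! ((hm s hs).mul (hp s hs)).mul h1 using 1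
    simp only [Pi.mul_apply]
    ring
  have hnn : ∀ s : ℝ, 0 ≤ (p s ^ 2 - ν * m s ^ 2) * Real.exp (-s ^ 2 / 2) := fun s =>
    mul_nonneg (by nlinarith [sq_nonneg (p s), sq_nonneg (m s)]) (Real.exp_pos _).le
  have hmono : MonotoneOn Q (Ioi 0) := by
    refine monotoneOn_of_deriv_nonneg (convex_Ioi 0)
      (fun s hs => (hQd s hs).continuousAt.continuousWithinAt)
      (fun s hs => (hQd s (by simpa using hs)).differentiableAt.differentiableWithinAt) fun s hs => ?_
    rw [(hQd s (by simpa using hs)).deriv]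
    exact hnn s
  have hlim0 : Tendsto Q (𝓝[>] 0) (𝓝 (m₀ * p₀)) := by
    have h1 : Tendsto (fun s : ℝ => Real.exp (-s ^ 2 / 2)) (𝓝[>] 0) (𝓝 1) := by
      have : Continuous fun s : ℝ => Real.exp (-s ^ 2 / 2) := by fun_prop
      simpa using (this.tendsto 0).mono_left (nhdsWithin_le_nhds (s := Ioi 0))
    simpa using (hm₀.mul hp₀).mul h1
  have hlim : Tendsto Q atTop (𝓝 0) := (gm.mul gp).tendsto_mul_exp
  have hQ0 : ∀ s > 0, Q s = 0 := by
    intro s hs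
    refine le_antisymm (ge_of_tendsto hlim ?_) (h0.trans (le_of_tendsto hlim0 ?_))
    · filter_upwards [eventually_ge_atTop s] with t ht
      exact hmono hs (lt_of_lt_of_le hs ht) ht
    · filter_upwards [Ioc_mem_nhdsGT hs] with t ht
      exact hmono ht.1 hs ht.2
  intro s hs
  have h1 : (p s ^ 2 - ν * m s ^ 2) * Real.exp (-s ^ 2 / 2) = 0 := by
    refine (hQd s hs).unique ((hasDerivAt_const s (0 : ℝ)).congr_of_eventuallyEq ?_)
    filter_upwards [lt_mem_nhds hs] with t ht using hQ0 t ht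
  have h2 : p s ^ 2 - ν * m s ^ 2 = 0 :=
    (mul_eq_zero.1 h1).resolve_right (Real.exp_pos _).ne'
  have h3 : m s ^ 2 = 0 := by nlinarith [sq_nonneg (p s), sq_nonneg (m s)]
  exact pow_eq_zero_iff (two_ne_zero) |>.1 h3

/-- Polynomially growing solutions of Hermite's equation `m'' = s m' - ν m` on the half line whose
initial data have suitable signs vanish. -/
theorem hermite_eq_zero (K : ℕ) : ∀ {ν m₀ p₀ : ℝ} {m p : ℝ → ℝ},
    (∀ s > 0, HasDerivAt m (p s) s) → (∀ s > 0, HasDerivAt p (s * p s - ν * m s) s) →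
    Tendsto m (𝓝[>] 0) (𝓝 m₀) → Tendsto p (𝓝[>] 0) (𝓝 p₀) → PolyGrowth m → PolyGrowth p →
    ν < K → (∀ i < K, ν ≠ i) → 0 ≤ m₀ * p₀ * ∏ i ∈ Finset.range K, ((i : ℝ) - ν) →
    ∀ s > 0, m s = 0 := by
  induction K with
  | zero =>
    intro ν m₀ p₀ m p hm hp hm₀ hp₀ gm gp hν _ h0
    exact hermite_eq_zero_of_neg hm hp hm₀ hp₀ gm gp (by simpa using hν) (by simpa using h0)
  | succ K ih =>
    intro ν m₀ p₀ m p hm hp hm₀ hp₀ gm gp hν hi h0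
    have hid : Tendsto (fun s : ℝ => s) (𝓝[>] 0) (𝓝 0) := nhdsWithin_le_nhds
    have hpz : ∀ s > 0, p s = 0 := by
      -- The derivative `p` solves the equation for `ν - 1` with initial data `p₀` and `-ν * m₀`;
      -- the factor `0 - ν` of the product accounts for the change.
      refine ih (ν := ν - 1) hp (p := fun s => s * p s - ν * m s) (fun s hs => ?_) hp₀
        ((hid.mul hp₀).sub (hm₀.const_mul ν)) gp
        ((polyGrowth_id.mul gp).sub ((polyGrowth_const ν).mul gm)) ?_ ?_ ?_
      · convert! ((hasDerivAt_id s).mul (hp s hs)).sub ((hm s hs).const_mul ν) using 1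
        simp only [id]
        ring
      · push_cast at hν; linarith
      · intro i hiK h
        exact hi (i + 1) (by omega) (by push_cast; linarith)
      · rw [Finset.prod_range_succ'] at h0
        have : ∏ i ∈ Finset.range K, ((i : ℝ) - (ν - 1)) =
            ∏ i ∈ Finset.range K, (((i + 1 : ℕ) : ℝ) - ν) :=
          Finset.prod_congr rfl fun i _ => by push_cast; ring
        rw [this]
        convert! h0 using 1
        push_cast; ring
    intro s hs
    -- With `p = 0` the equation reduces to ν m = 0, and ν ≠ 0.
    have h1 : s * p s - ν * m s = 0 := by
      refine (hp s hs).unique ((hasDerivAt_const s (0 : ℝ)).congr_of_eventuallyEq ?_)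
      filter_upwards [lt_mem_nhds hs] with t ht using hpz t ht
    rw [hpz s hs, mul_zero, zero_sub, neg_eq_zero] at h1
    exact (mul_eq_zero.1 h1).resolve_left (by simpa using hi 0 (by omega))

/-- Since (p - s m)' = -(ν + 1) m, the function p - s m + (ν + 1)∫m is constant, so continuity of
`m` up to 0 forces `p` to have a limit there. -/
theorem hermite_exists_tendsto_deriv {ν : ℝ} {m p : ℝ → ℝ} (hc : ContinuousOn m (Ici 0))
    (hm : ∀ s > 0, HasDerivAt m (p s) s) (hp : ∀ s > 0, HasDerivAt p (s * p s - ν * m s) s) :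
    ∃ p₀, Tendsto p (𝓝[>] 0) (𝓝 p₀) ∧ HasDerivWithinAt m p₀ (Ici 0) 0 := by
  set M : ℝ → ℝ := fun s => m (max s 0)
  have hM : Continuous M :=
    hc.comp_continuous (continuous_id.max continuous_const) fun s =>
      mem_Ici.2 (le_max_right s 0)
  have hMm : ∀ s > 0, M s = m s := fun s hs => by simp [M, max_eq_left (le_of_lt hs)]
  set F : ℝ → ℝ := fun s => ∫ r in (1 : ℝ)..s, M r
  have hF : ∀ s, HasDerivAt F (M s) s := fun s =>
    intervalIntegral.integral_hasDerivAt_right (hM.intervalIntegrable _ _)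
      hM.aestronglyMeasurable.stronglyMeasurableAtFilter hM.continuousAt
  have hd : ∀ s ∈ Ioi (0 : ℝ), HasDerivAt (fun s => p s - s * m s + (ν + 1) * F s) 0 s := by
    intro s hs
    convert! ((hp s hs).sub ((hasDerivAt_id s).mul (hm s hs))).add ((hF s).const_mul (ν + 1)) using 1
    rw [hMm s hs]
    simp only [id]
    ring
  obtain ⟨c, hcst⟩ : ∃ c, ∀ s > 0, p s = c + s * m s - (ν + 1) * F s := by
    refine ⟨p 1 - 1 * m 1 + (ν + 1) * F 1, fun s hs => ?_⟩
    have := (convex_Ioi (0 : ℝ)).is_const_of_fderivWithin_eq_zero (𝕜 := ℝ)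
      (f := fun s => p s - s * m s + (ν + 1) * F s)
      (fun s hs => (hd s hs).differentiableAt.differentiableWithinAt) (fun s hs => by
        rw [fderivWithin_of_isOpen isOpen_Ioi hs, (hd s hs).hasFDerivAt.fderiv]
        ext; simp) hs (show (1 : ℝ) ∈ Ioi 0 by simp)
    linarith
  have hFc : Continuous F := continuous_iff_continuousAt.2 fun s => (hF s).continuousAt
  have hlim : Tendsto p (𝓝[>] 0) (𝓝 (c + 0 * M 0 - (ν + 1) * F 0)) := by
    have h1 : Continuous fun s => c + s * M s - (ν + 1) * F s := by fun_prop
    refine ((h1.tendsto 0).mono_left nhdsWithin_le_nhds).congr' ?_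
    filter_upwards [self_mem_nhdsWithin] with s hs
    rw [hcst s hs, hMm s hs]
  refine ⟨_, hlim, ?_⟩
  refine hasDerivWithinAt_Ici_of_tendsto_deriv (s := Ioi 0)
    (fun s hs => (hm s hs).differentiableAt.differentiableWithinAt)
    ((hc 0 self_mem_Ici).mono Ioi_subset_Ici_self) self_mem_nhdsWithin (hlim.congr' ?_)
  filter_upwards [self_mem_nhdsWithin] with s hs using ((hm s hs).deriv).symm

end Hermite

end ThinObstacle

namespace ThinObstacle

open Set Filter Topology InnerProductSpace Laplacian Metric

/-! ### Splitting off the last coordinate -/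

section Coordinates

variable {d : ℕ}

/-- The inclusion `y ↦ (y, 0)` of `ℝᵈ` as the thin space. -/
noncomputable def thinIncl (d : ℕ) : EuclideanSpace ℝ (Fin d) →ₗᵢ[ℝ] Space d where
  toFun y := WithLp.toLp 2 (Fin.snoc (α := fun _ => ℝ) y.ofLp 0)
  map_add' x y := by
    ext i
    refine Fin.lastCases ?_ (fun j => ?_) i <;> simp
  map_smul' c x := by
    ext i
    refine Fin.lastCases ?_ (fun j => ?_) i <;> simp
  norm_map' x := by
    simp [EuclideanSpace.norm_eq, Fin.sum_univ_castSucc]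

@[simp] theorem thinIncl_castSucc (y : EuclideanSpace ℝ (Fin d)) (i : Fin d) :
    thinIncl d y i.castSucc = y i := by simp [thinIncl]

@[simp] theorem thinIncl_last (y : EuclideanSpace ℝ (Fin d)) :
    thinIncl d y (Fin.last d) = 0 := by simp [thinIncl]

theorem thinIncl_single (i : Fin d) :
    thinIncl d (EuclideanSpace.single i 1) = EuclideanSpace.single i.castSucc 1 := by
  ext j
  refine Fin.lastCases ?_ (fun k => ?_) j
  · simp [(Fin.castSucc_ne_last i).symm]
  · simp

/-- The point `(y, s)`. -/
noncomputable def point (y : EuclideanSpace ℝ (Fin d)) (s : ℝ) : Space d :=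
  thinIncl d y + s • eLast d

@[simp] theorem eLast_last : eLast d (Fin.last d) = 1 := by simp [eLast]

@[simp] theorem norm_eLast : ‖eLast d‖ = 1 := by simp [eLast]

theorem inner_eLast (x : Space d) : inner ℝ x (eLast d) = x (Fin.last d) := by
  simp [eLast, EuclideanSpace.inner_single_right]

@[simp] theorem point_last (y : EuclideanSpace ℝ (Fin d)) (s : ℝ) :
    point y s (Fin.last d) = s := by simp [point]

theorem norm_point_le (y : EuclideanSpace ℝ (Fin d)) (s : ℝ) : ‖point y s‖ ≤ ‖y‖ + |s| := by
  refine (norm_add_le _ _).trans ?_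
  rw [norm_smul, norm_eLast, mul_one, LinearIsometry.norm_map, Real.norm_eq_abs]

theorem exists_eq_point (x : Space d) : ∃ y, x = point y (x (Fin.last d)) := by
  refine ⟨WithLp.toLp 2 fun i => x i.castSucc, ?_⟩
  ext j
  refine Fin.lastCases ?_ (fun k => ?_) j
  · simp
  · simp [point, eLast, Fin.castSucc_ne_last]

theorem continuous_point : Continuous fun q : EuclideanSpace ℝ (Fin d) × ℝ => point q.1 q.2 := by
  unfold point
  exact ((thinIncl d).continuous.comp continuous_fst).add (continuous_snd.smul continuous_const)

theorem abs_last_sub_le (x z : Space d) : |z (Fin.last d) - x (Fin.last d)| ≤ ‖z - x‖ := by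
  have := abs_real_inner_le_norm (z - x) (eLast d)
  rwa [inner_eLast, norm_eLast, mul_one] at this

theorem LaplaceAt.sum_thin_add_last {u : Space d → ℝ} {x : Space d} (h : LaplaceAt u x) :
    ∑ i : Fin d, iteratedFDeriv ℝ 2 u x
      ![thinIncl d (EuclideanSpace.single i 1), thinIncl d (EuclideanSpace.single i 1)]
      + iteratedFDeriv ℝ 2 u x ![eLast d, eLast d] = 0 := by
  have := h.sum_eq_zero (EuclideanSpace.basisFun (Fin (d + 1)) ℝ)
  rw [Fin.sum_univ_castSucc] at this
  simpa only [EuclideanSpace.basisFun_apply, thinIncl_single, eLast] using this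

end Coordinates

/-! ### Derivative bounds and one-sided Lipschitz bound for the solution -/

section Estimates

variable {d : ℕ} {μ : ℝ} {u : Space d → ℝ}

theorem IsEntireSolution.exists_interior_bound (hu : IsEntireSolution μ u) :
    ∃ C : ℝ, 0 < C ∧ ∃ N : ℕ, ∀ x : Space d, 0 < x (Fin.last d) → ∀ v : Space d, ‖v‖ = 1 →
      |fderiv ℝ u x v| ≤ C * (1 + ‖x‖) ^ N / x (Fin.last d) ∧
      |iteratedFDeriv ℝ 2 u x ![v, v]| ≤ C * (1 + ‖x‖) ^ N / x (Fin.last d) ^ 2 := by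
  obtain ⟨C, hC, N, hN⟩ := hu.exists_growth
  set K : ℝ := Module.finrank ℝ (Space d) + 1
  have hK : 1 ≤ K := by simp only [K]; linarith [(Nat.cast_nonneg _ : (0 : ℝ) ≤
    Module.finrank ℝ (Space d))]
  -- On the ball of radius s/2 about `x`, 1 + ‖z‖ ≤ 2(1 + ‖x‖). The factors are 2K for the gradient
  -- and 16K² for the second derivative; the larger serves both.
  refine ⟨16 * C * 2 ^ N * K ^ 2, by positivity, N, fun x hx v hv => ?_⟩
  set s := x (Fin.last d) with hs
  set M : ℝ := C * (2 * (1 + ‖x‖)) ^ N with hM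
  have hM0 : 0 < M := by positivity
  have hr : 0 < s / 2 := by positivity
  have hsx : s ≤ ‖x‖ := by
    have := abs_last_sub_le 0 x
    simp only [PiLp.zero_apply, sub_zero] at this
    exact (le_abs_self s).trans this
  have hb : ∀ z ∈ closedBall x (s / 2), |u z| ≤ M := by
    intro z hz
    rw [mem_closedBall, dist_eq_norm] at hz
    refine (hN z).trans ?_
    have : ‖z‖ ≤ ‖x‖ + ‖z - x‖ := norm_le_norm_add_norm_sub' z x
    exact mul_le_mul_of_nonneg_left (pow_le_pow_left₀ (by positivity) (by linarith) N) hC.le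
  have hL : ∀ z ∈ closedBall x (s / 2), LaplaceAt u z := by
    intro z hz
    rw [mem_closedBall, dist_eq_norm] at hz
    refine hu.laplace z (ne_of_gt ?_)
    have := (abs_le.1 ((abs_last_sub_le x z).trans hz)).1
    linarith
  have hMC : M = C * 2 ^ N * (1 + ‖x‖) ^ N := by rw [hM, mul_pow]; ring
  constructor
  · refine (abs_fderiv_le_of_laplaceAt hr hM0 hv hb hL).trans ?_
    rw [hMC]
    calc C * 2 ^ N * (1 + ‖x‖) ^ N * K / (s / 2)
        = (C * 2 ^ N * (1 + ‖x‖) ^ N / s) * (2 * K) := by field_simp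
      _ ≤ (C * 2 ^ N * (1 + ‖x‖) ^ N / s) * (16 * K ^ 2) :=
          mul_le_mul_of_nonneg_left (by nlinarith) (by positivity)
      _ = _ := by field_simp
  · refine (abs_iteratedFDeriv_le_of_laplaceAt hr hM0 hv hb hL).trans (le_of_eq ?_)
    rw [hMC]
    change 4 * (C * 2 ^ N * (1 + ‖x‖) ^ N) * K ^ 2 / (s / 2) ^ 2 = _
    field_simp
    ring

/-- Reflect in {x_n = s/2}: above it `u` is harmonic, and below it `u` is harmonic up to a concave
crease on the thin space, which is what the comparison allows. -/
theorem IsEntireSolution.exists_one_sided_lipschitz (hu : IsEntireSolution μ u) :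
    ∃ C : ℝ, 0 < C ∧ ∃ N : ℕ, ∀ (y : EuclideanSpace ℝ (Fin d)), ∀ s ∈ Ioc (0 : ℝ) 1,
      u (point y s) - u (point y 0) ≤ C * (1 + ‖y‖) ^ N * s := by
  obtain ⟨C, hC, N, hN⟩ := hu.exists_growth
  set K : ℝ := Module.finrank ℝ (Space d) + 1
  refine ⟨C * 3 ^ N * K, by positivity, N, fun y s hs => ?_⟩
  set x₀ := point y (s / 2) with hx₀
  have hx₀n : ‖x₀‖ ≤ ‖y‖ + 1 := by
    have := norm_point_le y (s / 2)
    rw [abs_of_pos (by linarith [hs.1])] at this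
    linarith [hs.2]
  set M : ℝ := C * (3 * (1 + ‖y‖)) ^ N with hM
  have hM0 : 0 < M := by positivity
  have hb : ∀ z ∈ closedBall x₀ 1, |u z| ≤ M := by
    intro z hz
    rw [mem_closedBall, dist_eq_norm] at hz
    refine (hN z).trans ?_
    have : ‖z‖ ≤ ‖x₀‖ + ‖z - x₀‖ := norm_le_norm_add_norm_sub' z x₀
    refine mul_le_mul_of_nonneg_left (pow_le_pow_left₀ (by positivity) ?_ N) hC.le
    linarith [norm_nonneg y]
  have hin : ∀ x : Space d, inner ℝ (x - x₀) (-eLast d) = s / 2 - x (Fin.last d) := by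
    intro x
    rw [inner_neg_right, inner_eLast]
    simp [hx₀]
  have key := neg_le_sub_of_reflection (U := u) (x₀ := x₀) (v := -eLast d) (e := eLast d)
    one_pos hM0 (by simp) (by simp) hb hu.continuous.continuousOn
    (fun x _ _ hx => hu.laplace x (by rwa [inner_eLast] at hx)) ?_ ?_
    (t := s / 2) ⟨by linarith [hs.1], by linarith [hs.2]⟩
  · have h1 : x₀ + (s / 2) • -eLast d = point y 0 := by
      simp only [hx₀, point]; module
    have h2 : x₀ - (s / 2) • -eLast d = point y s := by
      simp only [hx₀, point]; module
    rw [h1, h2] at key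
    have h3 : 2 * M * K / 1 * (s / 2) = C * 3 ^ N * K * (1 + ‖y‖) ^ N * s := by
      rw [hM, mul_pow]; ring
    change -(2 * M * K / 1 * (s / 2)) ≤ _ at key
    rw [h3] at key
    linarith
  -- By evenness the derivatives along `eLast d` and its opposite agree, so the symmetric sum has
  -- derivative 2a ≤ 0.
  · intro x _ _ hx
    rw [inner_eLast] at hx
    obtain ⟨a, ha, hd⟩ := hu.deriv_nonpos x hx
    refine ⟨a + a, by linarith, (hd.add hd).congr_of_mem (fun t _ => ?_) self_mem_Ici⟩
    have : x + t • eLast d = reflectLast (x - t • eLast d) := by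
      simp only [reflectLast, PiLp.sub_apply, PiLp.smul_apply, hx, eLast_last, smul_eq_mul]
      module
    simp only [Pi.add_apply]
    rw [this, hu.even]
  · intro x _ hx
    refine hu.laplace _ (ne_of_gt ?_)
    rw [hin] at hx
    simp only [hyperplaneReflection, hin, PiLp.sub_apply, PiLp.smul_apply, PiLp.neg_apply,
      eLast_last, smul_eq_mul]
    linarith [hs.1]

end Estimates

end ThinObstacle

namespace ThinObstacle

open Set Filter Topology InnerProductSpace MeasureTheory Metric

/-! ### Gaussian weights: integrability and integration by parts -/

section Weights

variable {V : Type*} [NormedAddCommGroup V]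

/-- At most polynomial growth. -/
def PolyBdd (F : V → ℝ) : Prop := ∃ C : ℝ, ∃ N : ℕ, ∀ y, |F y| ≤ C * (1 + ‖y‖) ^ N

theorem PolyBdd.mul {F G : V → ℝ} (hF : PolyBdd F) (hG : PolyBdd G) :
    PolyBdd fun y => F y * G y := by
  obtain ⟨C, N, h⟩ := hF
  obtain ⟨C', N', h'⟩ := hG
  refine ⟨C * C', N + N', fun y => ?_⟩
  rw [abs_mul]
  calc |F y| * |G y| ≤ (C * (1 + ‖y‖) ^ N) * (C' * (1 + ‖y‖) ^ N') :=
        mul_le_mul (h y) (h' y) (abs_nonneg _) ((abs_nonneg _).trans (h y))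
    _ = _ := by ring

theorem polyBdd_const (c : ℝ) : PolyBdd fun _ : V => c := ⟨|c|, 0, fun y => by simp⟩

theorem polyBdd_pow (N : ℕ) : PolyBdd fun y : V => (1 + ‖y‖) ^ N :=
  ⟨1, N, fun y => by rw [abs_of_nonneg (by positivity), one_mul]⟩

/-- The Gaussian `exp (-‖y‖² / 2)`. -/
noncomputable def gauss (y : V) : ℝ := Real.exp (-‖y‖ ^ 2 / 2)

theorem gauss_pos (y : V) : 0 < gauss y := Real.exp_pos _

theorem continuous_gauss : Continuous (gauss : V → ℝ) := by unfold gauss; fun_prop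

variable [InnerProductSpace ℝ V]

theorem polyBdd_inner (a : V) : PolyBdd fun y : V => inner ℝ a y :=
  ⟨‖a‖, 1, fun y => (abs_real_inner_le_norm a y).trans (by
    rw [pow_one]; nlinarith [norm_nonneg a, norm_nonneg y])⟩

theorem polyBdd_inner_pow (a : V) (k : ℕ) : PolyBdd fun y : V => inner ℝ a y ^ k := by
  induction k with
  | zero => simpa using polyBdd_const (1 : ℝ)
  | succ k ih => simpa only [pow_succ] using ih.mul (polyBdd_inner a)

/-- The weight `⟪a, y⟫ᵏ exp (-‖y‖² / 2)`. -/
noncomputable def weight (a : V) (k : ℕ) (y : V) : ℝ := inner ℝ a y ^ k * gauss y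

theorem continuous_weight (a : V) (k : ℕ) : Continuous (weight a k) := by
  unfold weight
  exact (by fun_prop : Continuous fun y : V => inner ℝ a y ^ k).mul continuous_gauss

theorem hasLineDerivAt_weight (a v y : V) (k : ℕ) :
    HasLineDerivAt ℝ (weight a k)
      (k * inner ℝ a v * weight a (k - 1) y - inner ℝ v y * weight a k y) y v := by
  have h1 : HasDerivAt (fun t : ℝ => inner ℝ a (y + t • v) ^ k)
      (k * inner ℝ a y ^ (k - 1) * inner ℝ a v) 0 := by
    have h : HasDerivAt (fun t : ℝ => inner ℝ a y + t * inner ℝ a v) (inner ℝ a v) 0 := by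
      simpa using ((hasDerivAt_id (0 : ℝ)).mul_const (inner ℝ a v)).const_add (inner ℝ a y)
    simpa [inner_add_right, real_inner_smul_right] using h.fun_pow k
  have h2 : HasDerivAt (fun t : ℝ => gauss (y + t • v)) (gauss y * (-inner ℝ v y)) 0 := by
    have h : HasDerivAt (fun t : ℝ => -(‖y‖ ^ 2 + 2 * t * inner ℝ v y + t ^ 2 * ‖v‖ ^ 2) / 2)
        (-inner ℝ v y) 0 := by
      have := ((((hasDerivAt_id (0 : ℝ)).const_mul 2).mul_const (inner ℝ v y)).const_add
        (‖y‖ ^ 2)).add ((hasDerivAt_pow 2 (0 : ℝ)).mul_const (‖v‖ ^ 2))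
      convert! this.neg.div_const 2 using 1
      simp
      ring
    have h' := h.exp
    have he : (fun t : ℝ => gauss (y + t • v)) = fun t : ℝ =>
        Real.exp (-(‖y‖ ^ 2 + 2 * t * inner ℝ v y + t ^ 2 * ‖v‖ ^ 2) / 2) := by
      funext t
      rw [gauss, norm_add_sq_real, real_inner_smul_right, norm_smul, mul_pow, Real.norm_eq_abs,
        sq_abs, real_inner_comm y v]
      ring_nf
    rw [he]
    convert! h' using 1
    simp [gauss]
  have h3 := h1.mul h2
  unfold HasLineDerivAt weight
  convert! h3 using 1
  simp
  ring

variable [FiniteDimensional ℝ V] [MeasurableSpace V] [BorelSpace V]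

/-- The factor exp(c‖y‖) is needed to dominate the power series of exp(i⟪a, y⟫) in the determinacy
of moments. -/
theorem integrable_pow_mul_exp_mul_gauss (N : ℕ) (c : ℝ) :
    Integrable fun y : V => (1 + ‖y‖) ^ N * Real.exp (c * ‖y‖) * gauss y := by
  have h1 : Integrable fun y : V => Real.exp (-(1 / 4) * ‖y‖ ^ 2) := by
    have := (GaussianFourier.integrable_cexp_neg_mul_sq_norm_add (V := V) (b := 1 / 4)
      (by norm_num) 0 0).norm
    refine this.congr (.of_forall fun y => ?_)
    simp only [Complex.norm_exp]
    congr 1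
    simp [← Complex.ofReal_pow]
  refine (h1.const_mul (Real.exp ((N + c) ^ 2))).mono' ?_ (.of_forall fun y => ?_)
  · have : Continuous fun y : V => (1 + ‖y‖) ^ N * Real.exp (c * ‖y‖) * gauss y :=
      (by fun_prop : Continuous fun y : V => (1 + ‖y‖) ^ N * Real.exp (c * ‖y‖)).mul
        continuous_gauss
    exact this.aestronglyMeasurable
  · have h0 := gauss_pos y
    rw [Real.norm_of_nonneg (by positivity)]
    have h2 : (1 + ‖y‖) ^ N ≤ Real.exp (N * ‖y‖) := by
      rw [Real.exp_nat_mul]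
      exact pow_le_pow_left₀ (by positivity) (by linarith [Real.add_one_le_exp ‖y‖]) N
    calc (1 + ‖y‖) ^ N * Real.exp (c * ‖y‖) * gauss y
        ≤ Real.exp (N * ‖y‖) * Real.exp (c * ‖y‖) * gauss y := by gcongr
      _ = Real.exp (N * ‖y‖ + c * ‖y‖ + -‖y‖ ^ 2 / 2) := by rw [gauss, Real.exp_add, Real.exp_add]
      _ ≤ Real.exp ((N + c) ^ 2 + -(1 / 4) * ‖y‖ ^ 2) := by
          refine Real.exp_le_exp.2 ?_
          -- Completing the square.
          nlinarith [sq_nonneg ((N + c) - ‖y‖ / 2)]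
      _ = _ := Real.exp_add _ _

theorem PolyBdd.integrable_mul_gauss {F : V → ℝ} (hF : PolyBdd F) (hc : Continuous F) :
    Integrable fun y => F y * gauss y := by
  obtain ⟨C, N, h⟩ := hF
  refine ((integrable_pow_mul_exp_mul_gauss (V := V) N 0).const_mul C).mono'
    (hc.mul continuous_gauss).aestronglyMeasurable (.of_forall fun y => ?_)
  rw [norm_mul, Real.norm_of_nonneg (gauss_pos y).le, zero_mul, Real.exp_zero, mul_one, ← mul_assoc]
  exact mul_le_mul_of_nonneg_right (h y) (gauss_pos y).le

theorem PolyBdd.integrable_mul_weight {F : V → ℝ} (hF : PolyBdd F) (hc : Continuous F) (a : V)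
    (k : ℕ) : Integrable fun y => F y * weight a k y := by
  have := (hF.mul (polyBdd_inner_pow a k)).integrable_mul_gauss
    (hc.mul (by fun_prop : Continuous fun y : V => inner ℝ a y ^ k))
  simpa only [weight, mul_assoc] using this

theorem integral_lineDeriv_mul_weight {F F' : V → ℝ} {v : V} (a : V) (k : ℕ)
    (hF : ∀ y, HasLineDerivAt ℝ F (F' y) y v) (hc : Continuous F) (hc' : Continuous F')
    (hb : PolyBdd F) (hb' : PolyBdd F') :
    ∫ y, F' y * weight a k y =
      ∫ y, F y * (inner ℝ v y * weight a k y - k * inner ℝ a v * weight a (k - 1) y) := by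
  have h1 : Integrable fun y => F y * (k * inner ℝ a v * weight a (k - 1) y
      - inner ℝ v y * weight a k y) := by
    have e1 := (hb.integrable_mul_weight hc a (k - 1)).const_mul (k * inner ℝ a v)
    have e2 := (hb.mul (polyBdd_inner v)).integrable_mul_weight
      (hc.mul (by fun_prop : Continuous fun y : V => inner ℝ v y)) a k
    refine (e1.sub e2).congr (.of_forall fun y => ?_)
    simp only [Pi.sub_apply]; ring
  have := integral_bilinear_hasLineDerivAt_right_eq_neg_left_of_integrable (μ := volume)
    (B := ContinuousLinearMap.mul ℝ ℝ) (f := F) (g := weight a k)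
    (hb'.integrable_mul_weight hc' a k) h1 (hb.integrable_mul_weight hc a k)
    (fun y _ => hF y) (fun y _ => hasLineDerivAt_weight a v y k)
  simp only [ContinuousLinearMap.mul_apply'] at this
  rw [eq_neg_iff_add_eq_zero, add_comm, ← eq_neg_iff_add_eq_zero, ← integral_neg] at this
  rw [this]
  congr 1; funext y; ring

/-- Differentiation under the integral sign against a Gaussian weight. -/
theorem hasDerivAt_integral_mul_weight {G G' : V → ℝ → ℝ} {s₀ C : ℝ} {N : ℕ} (a : V) (k : ℕ)
    (hs₀ : 0 < s₀) (hG : ∀ s > 0, Continuous fun y => G y s)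
    (hG' : Continuous fun y => G' y s₀) (hb : PolyBdd fun y => G y s₀)
    (hd : ∀ y, ∀ s > 0, HasDerivAt (G y) (G' y s) s)
    (hb' : ∀ s ∈ ball s₀ (s₀ / 2), ∀ y, |G' y s| ≤ C * (1 + ‖y‖) ^ N) :
    HasDerivAt (fun s => ∫ y, G y s * weight a k y) (∫ y, G' y s₀ * weight a k y) s₀ := by
  have hball : ∀ s ∈ ball s₀ (s₀ / 2), 0 < s := by
    intro s hs
    have := (abs_lt.1 (by simpa [Real.dist_eq] using hs)).1
    linarith
  refine (hasDerivAt_integral_of_dominated_loc_of_deriv_le (μ := volume)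
    (F := fun s y => G y s * weight a k y) (F' := fun s y => G' y s * weight a k y)
    (s := ball s₀ (s₀ / 2)) (bound := fun y => C * (‖(1 + ‖y‖) ^ N * weight a k y‖))
    (ball_mem_nhds s₀ (by positivity))
    ?_ ?_ ?_ ?_ ?_ ?_).2
  · filter_upwards [lt_mem_nhds hs₀] with s hs
    exact ((hG s hs).mul (continuous_weight a k)).aestronglyMeasurable
  · exact hb.integrable_mul_weight (hG s₀ hs₀) a k
  · exact (hG'.mul (continuous_weight a k)).aestronglyMeasurable
  · refine .of_forall fun y s hs => ?_
    rw [norm_mul, norm_mul, ← mul_assoc, Real.norm_of_nonneg (by positivity : 0 ≤ (1 + ‖y‖) ^ N)]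
    exact mul_le_mul_of_nonneg_right (hb' s hs y) (norm_nonneg _)
  · exact (((polyBdd_pow N).integrable_mul_weight (by fun_prop) a k).norm).const_mul C
  · refine .of_forall fun y s hs => ?_
    exact (hd y s (hball s hs)).mul_const _

end Weights

end ThinObstacle

namespace ThinObstacle

open Set Filter Topology InnerProductSpace MeasureTheory Metric

/-! ### The differential equation for the Gaussian moments -/

section Moments

variable {d : ℕ} {μ : ℝ} {u : Space d → ℝ}

/-- The Gaussian moment of `u` at height `s`. -/
noncomputable def moment (u : Space d → ℝ) (a : EuclideanSpace ℝ (Fin d)) (k : ℕ) (s : ℝ) : ℝ :=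
  ∫ y, u (point y s) * weight a k y

/-- The Gaussian moment of the vertical derivative of `u` at height `s`. -/
noncomputable def momentDeriv (u : Space d → ℝ) (a : EuclideanSpace ℝ (Fin d)) (k : ℕ) (s : ℝ) :
    ℝ :=
  ∫ y, fderiv ℝ u (point y s) (eLast d) * weight a k y

theorem point_add_smul (y v : EuclideanSpace ℝ (Fin d)) (s t : ℝ) :
    point (y + t • v) s = point y s + t • thinIncl d v := by
  simp only [point, map_add, map_smul]; abel

theorem continuous_point_left (s : ℝ) : Continuous fun y : EuclideanSpace ℝ (Fin d) => point y s :=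
  continuous_point.comp (continuous_id.prodMk continuous_const)

namespace IsEntireSolution

theorem laplace_point (hu : IsEntireSolution μ u) (y : EuclideanSpace ℝ (Fin d)) {s : ℝ}
    (hs : 0 < s) : LaplaceAt u (point y s) :=
  hu.laplace _ (by rw [point_last]; exact hs.ne')

/-- One pair of constants for all three bounds, with the growth in `y` and in `s` factorised, so
that domination in `y` is locally uniform in `s > 0`. -/
theorem exists_bounds (hu : IsEntireSolution μ u) : ∃ C : ℝ, 0 < C ∧ ∃ N : ℕ,
    (∀ s : ℝ, ∀ y : EuclideanSpace ℝ (Fin d),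
      |u (point y s)| ≤ C * (1 + ‖y‖) ^ N * (1 + |s|) ^ N) ∧
    ∀ s : ℝ, 0 < s → ∀ y : EuclideanSpace ℝ (Fin d), ∀ w : Space d, ‖w‖ = 1 →
      |fderiv ℝ u (point y s) w| ≤ C * (1 + ‖y‖) ^ N * (1 + s) ^ N / s ∧
      |iteratedFDeriv ℝ 2 u (point y s) ![w, w]| ≤ C * (1 + ‖y‖) ^ N * (1 + s) ^ N / s ^ 2 := by
  obtain ⟨C, hC, N, hN⟩ := hu.exists_growth
  obtain ⟨C', hC', N', hN'⟩ := hu.exists_interior_bound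
  have hx : ∀ (y : EuclideanSpace ℝ (Fin d)) (s : ℝ), 1 + ‖point y s‖ ≤ (1 + ‖y‖) * (1 + |s|) := by
    intro y s
    nlinarith [norm_point_le y s, mul_nonneg (norm_nonneg y) (abs_nonneg s)]
  have hp : ∀ (y : EuclideanSpace ℝ (Fin d)) (s c : ℝ) (n : ℕ), 0 < c → c ≤ C + C' → n ≤ N + N' →
      c * (1 + ‖point y s‖) ^ n ≤ (C + C') * (1 + ‖y‖) ^ (N + N') * (1 + |s|) ^ (N + N') := by
    intro y s c n hc hc' hn
    rw [mul_assoc, ← mul_pow]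
    have h1 : 1 ≤ (1 + ‖y‖) * (1 + |s|) := by
      nlinarith [norm_nonneg y, abs_nonneg s, mul_nonneg (norm_nonneg y) (abs_nonneg s)]
    refine mul_le_mul hc' ?_ (by positivity) (by positivity)
    exact (pow_le_pow_left₀ (by positivity) (hx y s) n).trans (pow_le_pow_right₀ h1 hn)
  refine ⟨C + C', by positivity, N + N', fun s y => (hN _).trans
    (hp y s C N hC (by linarith) (by omega)), fun s hs y w hw => ?_⟩
  have h1 := hN' (point y s) (by rw [point_last]; exact hs) w hw
  have h2 := hp y s C' N' hC' (by linarith) (by omega)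
  rw [point_last] at h1
  rw [abs_of_pos hs] at h2
  exact ⟨h1.1.trans (by gcongr), h1.2.trans (by gcongr)⟩

theorem polyBdd_point (hu : IsEntireSolution μ u) (s : ℝ) :
    PolyBdd fun y : EuclideanSpace ℝ (Fin d) => u (point y s) := by
  obtain ⟨C, _, N, h, _⟩ := hu.exists_bounds
  exact ⟨C * (1 + |s|) ^ N, N, fun y => (h s y).trans (le_of_eq (by ring))⟩

theorem polyBdd_fderiv (hu : IsEntireSolution μ u) {s : ℝ} (hs : 0 < s) (w : Space d) :
    PolyBdd fun y : EuclideanSpace ℝ (Fin d) => fderiv ℝ u (point y s) w := by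
  obtain ⟨C, _, N, _, h⟩ := hu.exists_bounds
  by_cases hw : w = 0
  · exact ⟨0, 0, fun y => by simp [hw]⟩
  have hw' : 0 < ‖w‖ := norm_pos_iff.2 hw
  refine ⟨‖w‖ * (C * (1 + s) ^ N / s), N, fun y => ?_⟩
  have h1 := (h s hs y (‖w‖⁻¹ • w) (by rw [norm_smul, norm_inv, norm_norm,
    inv_mul_cancel₀ hw'.ne'])).1
  rw [map_smul, smul_eq_mul, abs_mul, abs_inv, abs_norm, inv_mul_le_iff₀ hw'] at h1
  exact h1.trans (le_of_eq (by ring))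

theorem polyBdd_iteratedFDeriv (hu : IsEntireSolution μ u) {s : ℝ} (hs : 0 < s) {w : Space d}
    (hw : ‖w‖ = 1) :
    PolyBdd fun y : EuclideanSpace ℝ (Fin d) => iteratedFDeriv ℝ 2 u (point y s) ![w, w] := by
  obtain ⟨C, _, N, _, h⟩ := hu.exists_bounds
  exact ⟨C * (1 + s) ^ N / s ^ 2, N, fun y => ((h s hs y w hw).2).trans (le_of_eq (by ring))⟩

theorem continuous_fderiv_point (hu : IsEntireSolution μ u) {s : ℝ} (hs : 0 < s) (w : Space d) :
    Continuous fun y : EuclideanSpace ℝ (Fin d) => fderiv ℝ u (point y s) w := by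
  refine continuous_iff_continuousAt.2 fun y => ?_
  exact (differentiableAt_fderiv_apply (hu.laplace_point y hs).1 w).continuousAt.comp
    (f := fun y => point y s) (continuous_point_left s).continuousAt

theorem continuous_iteratedFDeriv_point (hu : IsEntireSolution μ u) {s : ℝ} (hs : 0 < s)
    (w : Space d) :
    Continuous fun y : EuclideanSpace ℝ (Fin d) => iteratedFDeriv ℝ 2 u (point y s) ![w, w] := by
  refine continuous_iff_continuousAt.2 fun y => ?_
  have h1 : ContinuousAt (iteratedFDeriv ℝ 2 u) (point y s) :=
    ((hu.laplace_point y hs).1.iteratedFDeriv_right (m := 0) (i := 2) (by norm_num)).continuousAt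
  have h2 : ContinuousAt (fun x => iteratedFDeriv ℝ 2 u x ![w, w]) (point y s) :=
    (ContinuousMultilinearMap.apply ℝ (fun _ : Fin 2 => Space d) ℝ
      ![w, w]).continuous.continuousAt.comp h1
  exact h2.comp (f := fun y => point y s) (continuous_point_left s).continuousAt

theorem hasDerivAt_point (hu : IsEntireSolution μ u) (y : EuclideanSpace ℝ (Fin d)) {s : ℝ}
    (hs : 0 < s) :
    HasDerivAt (fun s => u (point y s)) (fderiv ℝ u (point y s) (eLast d)) s :=
  hasDerivAt_line' ((hu.laplace_point y hs).1.differentiableAt (by norm_num))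

theorem hasDerivAt_fderiv_point (hu : IsEntireSolution μ u) (y : EuclideanSpace ℝ (Fin d)) {s : ℝ}
    (hs : 0 < s) :
    HasDerivAt (fun s => fderiv ℝ u (point y s) (eLast d))
      (iteratedFDeriv ℝ 2 u (point y s) ![eLast d, eLast d]) s := by
  have h := (hu.laplace_point y hs).1
  rw [← fderiv_fderiv_apply h]
  exact hasDerivAt_line' (f := fun z => fderiv ℝ u z (eLast d))
    (differentiableAt_fderiv_apply h _)

theorem hasLineDerivAt_point (hu : IsEntireSolution μ u) (y v : EuclideanSpace ℝ (Fin d)) {s : ℝ}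
    (hs : 0 < s) :
    HasLineDerivAt ℝ (fun y => u (point y s)) (fderiv ℝ u (point y s) (thinIncl d v)) y v := by
  unfold HasLineDerivAt
  simp only [point_add_smul]
  exact hasDerivAt_line ((hu.laplace_point y hs).1.differentiableAt (by norm_num)) _

theorem hasLineDerivAt_fderiv_point (hu : IsEntireSolution μ u) (y v : EuclideanSpace ℝ (Fin d))
    {s : ℝ} (hs : 0 < s) :
    HasLineDerivAt ℝ (fun y => fderiv ℝ u (point y s) (thinIncl d v))
      (iteratedFDeriv ℝ 2 u (point y s) ![thinIncl d v, thinIncl d v]) y v := by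
  have h := (hu.laplace_point y hs).1
  unfold HasLineDerivAt
  simp only [point_add_smul]
  rw [← fderiv_fderiv_apply h]
  exact hasDerivAt_line (differentiableAt_fderiv_apply h _) _

/-- Euler's identity. -/
theorem fderiv_self (hu : IsEntireSolution μ u) {x : Space d} (hx : DifferentiableAt ℝ u x) :
    fderiv ℝ u x x = μ * u x := by
  have h1 := hasDerivAt_line hx x
  have h2 : HasDerivAt (fun t : ℝ => (1 + t) ^ μ * u x) (μ * u x) 0 := by
    have := (((hasDerivAt_id (0 : ℝ)).const_add 1).rpow_const (p := μ) (Or.inl (by simp))).mul_const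
      (u x)
    convert! this using 1
    simp
  refine h1.unique (h2.congr_of_eventuallyEq ?_)
  filter_upwards [lt_mem_nhds (show (-1 : ℝ) < 0 by norm_num)] with t ht
  rw [← hu.homogeneous (1 + t) (by linarith), add_smul, one_smul]

theorem hasDerivAt_moment (hu : IsEntireSolution μ u) (a : EuclideanSpace ℝ (Fin d)) (k : ℕ)
    {s : ℝ} (hs : 0 < s) : HasDerivAt (moment u a k) (momentDeriv u a k s) s := by
  obtain ⟨C, hC, N, _, h⟩ := hu.exists_bounds
  refine hasDerivAt_integral_mul_weight (G := fun y s => u (point y s))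
    (G' := fun y s => fderiv ℝ u (point y s) (eLast d)) (C := C * (1 + 2 * s) ^ N / (s / 2)) (N := N)
    a k hs (fun s _ => hu.continuous.comp (continuous_point_left s))
    (hu.continuous_fderiv_point hs _) (hu.polyBdd_point s) (fun y s hs => hu.hasDerivAt_point y hs) ?_
  intro t ht y
  have ht' := abs_lt.1 (by simpa [Real.dist_eq] using ht)
  have ht0 : 0 < t := by linarith
  calc _ ≤ C * (1 + ‖y‖) ^ N * (1 + t) ^ N / t := (h t ht0 y _ norm_eLast).1
    _ ≤ C * (1 + ‖y‖) ^ N * (1 + 2 * s) ^ N / (s / 2) := by gcongr <;> linarith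
    _ = _ := by ring

theorem hasDerivAt_momentDeriv (hu : IsEntireSolution μ u) (a : EuclideanSpace ℝ (Fin d)) (k : ℕ)
    {s : ℝ} (hs : 0 < s) : HasDerivAt (momentDeriv u a k)
      (∫ y, iteratedFDeriv ℝ 2 u (point y s) ![eLast d, eLast d] * weight a k y) s := by
  obtain ⟨C, hC, N, _, h⟩ := hu.exists_bounds
  refine hasDerivAt_integral_mul_weight (G := fun y s => fderiv ℝ u (point y s) (eLast d))
    (G' := fun y s => iteratedFDeriv ℝ 2 u (point y s) ![eLast d, eLast d])
    (C := C * (1 + 2 * s) ^ N / (s / 2) ^ 2) (N := N)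
    a k hs (fun s hs => hu.continuous_fderiv_point hs _)
    (hu.continuous_iteratedFDeriv_point hs _) (hu.polyBdd_fderiv hs _)
    (fun y s hs => hu.hasDerivAt_fderiv_point y hs) ?_
  intro t ht y
  have ht' := abs_lt.1 (by simpa [Real.dist_eq] using ht)
  have ht0 : 0 < t := by linarith
  calc _ ≤ C * (1 + ‖y‖) ^ N * (1 + t) ^ N / t ^ 2 := (h t ht0 y _ norm_eLast).2
    _ ≤ C * (1 + ‖y‖) ^ N * (1 + 2 * s) ^ N / (s / 2) ^ 2 := by gcongr <;> linarith
    _ = _ := by ring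

theorem integral_fderiv_mul_weight (hu : IsEntireSolution μ u) (a : EuclideanSpace ℝ (Fin d))
    (k : ℕ) {s : ℝ} (hs : 0 < s) :
    ∫ y, fderiv ℝ u (point y s) (thinIncl d a) * weight a k y =
      moment u a (k + 1) s - k * ‖a‖ ^ 2 * moment u a (k - 1) s := by
  have hc : Continuous fun y : EuclideanSpace ℝ (Fin d) => u (point y s) :=
    hu.continuous.comp (continuous_point_left s)
  rw [integral_lineDeriv_mul_weight a k (fun y => hu.hasLineDerivAt_point y a hs) hc
    (hu.continuous_fderiv_point hs _) (hu.polyBdd_point s) (hu.polyBdd_fderiv hs _)]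
  unfold moment
  rw [← integral_const_mul, ← integral_sub ((hu.polyBdd_point s).integrable_mul_weight hc _ _)
    (((hu.polyBdd_point s).integrable_mul_weight hc _ _).const_mul _)]
  congr 1; funext y
  rw [real_inner_self_eq_norm_sq]
  simp only [weight, pow_succ]
  ring

/-- The Gaussian moments satisfy an inhomogeneous Hermite equation. -/
theorem integral_iteratedFDeriv_mul_weight (hu : IsEntireSolution μ u)
    (a : EuclideanSpace ℝ (Fin d)) (k : ℕ) {s : ℝ} (hs : 0 < s) :
    ∫ y, iteratedFDeriv ℝ 2 u (point y s) ![eLast d, eLast d] * weight a k y =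
      s * momentDeriv u a k s - (μ - k) * moment u a k s
        - k * ((k - 1 : ℕ) * ‖a‖ ^ 2 * moment u a (k - 2) s) := by
  set b : Fin d → EuclideanSpace ℝ (Fin d) := fun i => EuclideanSpace.single i 1
  have hb : ∀ v : EuclideanSpace ℝ (Fin d), ∑ i, v i • b i = v := by
    intro v
    have := (EuclideanSpace.basisFun (Fin d) ℝ).sum_repr v
    simpa [b] using this
  have hbn : ∀ i, ‖thinIncl d (b i)‖ = 1 := fun i => by simp [b]
  have hc : Continuous fun y : EuclideanSpace ℝ (Fin d) => u (point y s) :=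
    hu.continuous.comp (continuous_point_left s)
  have hcw : ∀ w : Space d, Integrable fun y : EuclideanSpace ℝ (Fin d) =>
      fderiv ℝ u (point y s) w * weight a k y :=
    fun w => (hu.polyBdd_fderiv hs w).integrable_mul_weight (hu.continuous_fderiv_point hs w) a k
  have h1 : ∫ y, iteratedFDeriv ℝ 2 u (point y s) ![eLast d, eLast d] * weight a k y =
      -∑ i, ∫ y, iteratedFDeriv ℝ 2 u (point y s) ![thinIncl d (b i), thinIncl d (b i)]
        * weight a k y := by
    rw [← integral_finsetSum _ fun i _ => (hu.polyBdd_iteratedFDeriv hs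
      (hbn i)).integrable_mul_weight (hu.continuous_iteratedFDeriv_point hs _) a k, ← integral_neg]
    congr 1; funext y
    have := (hu.laplace_point y hs).sum_thin_add_last
    rw [← Finset.sum_mul, eq_neg_of_add_eq_zero_right this]
    ring
  -- One tangential derivative is moved onto the weight; the sum over i then involves only y·∇'u and
  -- a·∇'u.
  have h2 : ∀ i, ∫ y, iteratedFDeriv ℝ 2 u (point y s) ![thinIncl d (b i), thinIncl d (b i)]
        * weight a k y = ∫ y, fderiv ℝ u (point y s) (thinIncl d (b i)) *
          (y i * weight a k y - k * a i * weight a (k - 1) y) := by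
    intro i
    rw [integral_lineDeriv_mul_weight a k (fun y => hu.hasLineDerivAt_fderiv_point y (b i) hs)
      (hu.continuous_fderiv_point hs _) (hu.continuous_iteratedFDeriv_point hs _)
      (hu.polyBdd_fderiv hs _) (hu.polyBdd_iteratedFDeriv hs (hbn i))]
    congr 1; funext y
    simp [b, EuclideanSpace.inner_single_left, EuclideanSpace.inner_single_right]
  have h3 : ∀ i, Integrable fun y : EuclideanSpace ℝ (Fin d) =>
      fderiv ℝ u (point y s) (thinIncl d (b i)) *
          (y i * weight a k y - k * a i * weight a (k - 1) y) := by
    intro i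
    have e1 := ((hu.polyBdd_fderiv hs (thinIncl d (b i))).mul
      (polyBdd_inner (b i))).integrable_mul_weight ((hu.continuous_fderiv_point hs _).mul
        (by fun_prop)) a k
    have e2 := ((hu.polyBdd_fderiv hs (thinIncl d (b i))).integrable_mul_weight
      (hu.continuous_fderiv_point hs _) a (k - 1)).const_mul (k * a i)
    refine (e1.sub e2).congr (.of_forall fun y => ?_)
    simp [b, EuclideanSpace.inner_single_left]
    ring
  have h4 : ∀ y : EuclideanSpace ℝ (Fin d), ∑ i, fderiv ℝ u (point y s) (thinIncl d (b i)) *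
      (y i * weight a k y - k * a i * weight a (k - 1) y) =
      (μ * (u (point y s) * weight a k y)
        - s * (fderiv ℝ u (point y s) (eLast d) * weight a k y))
      - k * (fderiv ℝ u (point y s) (thinIncl d a) * weight a (k - 1) y) := by
    intro y
    have e1 : ∀ v : EuclideanSpace ℝ (Fin d), ∑ i, v i * fderiv ℝ u (point y s) (thinIncl d (b i))
        = fderiv ℝ u (point y s) (thinIncl d v) := by
      intro v
      conv_rhs => rw [← hb v]
      simp [map_sum]
    -- Euler's identity: the only place where the degree enters the equation.
    have e2 : fderiv ℝ u (point y s) (thinIncl d y) =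
        μ * u (point y s) - s * fderiv ℝ u (point y s) (eLast d) := by
      rw [← hu.fderiv_self ((hu.laplace_point y hs).1.differentiableAt (by norm_num)), eq_sub_iff_add_eq,
        ← smul_eq_mul, ← map_smul, ← map_add]
      rfl
    calc _ = (∑ i, y i * fderiv ℝ u (point y s) (thinIncl d (b i))) * weight a k y
          - k * ((∑ i, a i * fderiv ℝ u (point y s) (thinIncl d (b i))) * weight a (k - 1) y) := by
          rw [Finset.sum_mul, Finset.sum_mul, Finset.mul_sum, ← Finset.sum_sub_distrib]
          exact Finset.sum_congr rfl fun i _ => by ring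
      _ = _ := by rw [e1, e1, e2]; ring
  have i1 := ((hu.polyBdd_point s).integrable_mul_weight hc a k).const_mul μ
  have i2 := (hcw (eLast d)).const_mul s
  have i12 : Integrable fun y : EuclideanSpace ℝ (Fin d) => μ * (u (point y s) * weight a k y)
      - s * (fderiv ℝ u (point y s) (eLast d) * weight a k y) := i1.sub i2
  have i3 := ((hu.polyBdd_fderiv hs (thinIncl d a)).integrable_mul_weight
    (hu.continuous_fderiv_point hs _) a (k - 1)).const_mul (k : ℝ)
  rw [h1, Finset.sum_congr rfl fun i _ => h2 i, ← integral_finsetSum _ fun i _ => h3 i]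
  simp only [h4]
  rw [integral_sub i12 i3, integral_sub i1 i2, integral_const_mul, integral_const_mul,
    integral_const_mul, hu.integral_fderiv_mul_weight a (k - 1) hs]
  change -(μ * moment u a k s - s * momentDeriv u a k s - _) = _
  -- For k = 0 the truncated subtractions are harmless because of the factor k.
  rcases Nat.eq_zero_or_pos k with rfl | hk
  · simp
  · rw [Nat.sub_add_cancel hk, Nat.sub_sub]
    ring

theorem polyGrowth_moment (hu : IsEntireSolution μ u) (a : EuclideanSpace ℝ (Fin d)) (k : ℕ) :
    PolyGrowth (moment u a k) ∧ PolyGrowth (momentDeriv u a k) := by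
  obtain ⟨C, hC, N, h, h'⟩ := hu.exists_bounds
  have hint : Integrable fun y : EuclideanSpace ℝ (Fin d) => ‖(1 + ‖y‖) ^ N * weight a k y‖ :=
    ((polyBdd_pow N).integrable_mul_weight (by fun_prop) a k).norm
  have key : ∀ G : EuclideanSpace ℝ (Fin d) → ℝ → ℝ,
      (∀ s ≥ 1, ∀ y, |G y s| ≤ C * (1 + ‖y‖) ^ N * (1 + s) ^ N) →
      PolyGrowth fun s => ∫ y, G y s * weight a k y := by
    intro G hG
    refine ⟨C * 2 ^ N * ∫ y : EuclideanSpace ℝ (Fin d), ‖(1 + ‖y‖) ^ N * weight a k y‖, N,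
      fun s hs => ?_⟩
    have h1 := norm_integral_le_of_norm_le (f := fun y => G y s * weight a k y)
      (hint.const_mul (C * (1 + s) ^ N)) (.of_forall fun y => by
        rw [norm_mul, norm_mul, Real.norm_of_nonneg (by positivity : 0 ≤ (1 + ‖y‖) ^ N),
          ← mul_assoc]
        refine mul_le_mul_of_nonneg_right ((hG s hs y).trans (le_of_eq (by ring))) (norm_nonneg _))
    rw [integral_const_mul] at h1
    refine h1.trans ?_
    have h2 : (1 + s) ^ N ≤ 2 ^ N * s ^ N := by
      rw [← mul_pow]; exact pow_le_pow_left₀ (by linarith) (by linarith) N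
    have h3 : 0 ≤ ∫ y : EuclideanSpace ℝ (Fin d), ‖(1 + ‖y‖) ^ N * weight a k y‖ :=
      integral_nonneg fun y => norm_nonneg _
    calc _ ≤ C * (2 ^ N * s ^ N) * ∫ y : EuclideanSpace ℝ (Fin d), ‖(1 + ‖y‖) ^ N * weight a k y‖ := by
          gcongr
      _ = _ := by ring
  constructor
  · refine key _ fun s hs y => (h s y).trans (le_of_eq ?_)
    rw [abs_of_pos (by linarith)]
  · refine key _ fun s hs y => ((h' s (by linarith) y _ norm_eLast).1).trans ?_
    exact div_le_self (by positivity) hs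

theorem continuous_moment (hu : IsEntireSolution μ u) (a : EuclideanSpace ℝ (Fin d)) (k : ℕ) :
    Continuous (moment u a k) := by
  obtain ⟨C, hC, N, h, _⟩ := hu.exists_bounds
  refine continuous_iff_continuousAt.2 fun s₀ => ?_
  refine continuousAt_of_dominated
    (bound := fun y => C * (2 + |s₀|) ^ N * ‖(1 + ‖y‖) ^ N * weight a k y‖) ?_ ?_ ?_ ?_
  · exact .of_forall fun s => ((hu.continuous.comp (continuous_point_left s)).mul
      (continuous_weight a k)).aestronglyMeasurable
  · filter_upwards [ball_mem_nhds s₀ one_pos] with s hs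
    refine .of_forall fun y => ?_
    rw [mem_ball, Real.dist_eq] at hs
    have h1 : 1 + |s| ≤ 2 + |s₀| := by
      have := abs_sub_abs_le_abs_sub s s₀
      linarith
    rw [norm_mul, norm_mul, Real.norm_of_nonneg (by positivity : 0 ≤ (1 + ‖y‖) ^ N), ← mul_assoc]
    refine mul_le_mul_of_nonneg_right ((h s y).trans ?_) (norm_nonneg _)
    calc C * (1 + ‖y‖) ^ N * (1 + |s|) ^ N ≤ C * (1 + ‖y‖) ^ N * (2 + |s₀|) ^ N := by gcongr
      _ = _ := by ring
  · exact (((polyBdd_pow N).integrable_mul_weight (by fun_prop) a k).norm).const_mul _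
  · refine .of_forall fun y => ?_
    have : Continuous fun s : ℝ => u (point y s) :=
      hu.continuous.comp (continuous_point.comp (continuous_const.prodMk continuous_id))
    exact (this.mul continuous_const).continuousAt

end IsEntireSolution

end Moments

end ThinObstacle

namespace ThinObstacle

open Set Filter Topology InnerProductSpace MeasureTheory Metric FourierTransform

/-! ### Determinacy by Gaussian moments -/

section Fourier

variable {V : Type*} [NormedAddCommGroup V] [InnerProductSpace ℝ V] [FiniteDimensional ℝ V]
  [MeasurableSpace V] [BorelSpace V]

/-- A continuous function of polynomial growth is determined by its Gaussian moments. -/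
theorem eq_zero_of_integral_mul_weight_eq_zero {F : V → ℝ} (hc : Continuous F) (hb : PolyBdd F)
    (h : ∀ a k, ∫ y, F y * weight a k y = 0) : F = 0 := by
  set f : V → ℂ := fun y => ((F y * gauss y : ℝ) : ℂ) with hf
  have hfc : Continuous f := Complex.continuous_ofReal.comp (hc.mul continuous_gauss)
  have hfi : Integrable f := (hb.integrable_mul_gauss hc).ofReal
  have hexp : ∀ a : V, Integrable fun y : V => |F y * gauss y| * Real.exp (‖a‖ * ‖y‖) := by
    intro a
    obtain ⟨C, N, hCN⟩ := id hb
    refine ((integrable_pow_mul_exp_mul_gauss (V := V) N ‖a‖).const_mul C).mono'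
      ((hc.mul continuous_gauss).abs.mul (by fun_prop)).aestronglyMeasurable
      (.of_forall fun y => ?_)
    rw [Real.norm_of_nonneg (by positivity), abs_mul, abs_of_pos (gauss_pos y)]
    have := mul_le_mul_of_nonneg_right (hCN y)
      (mul_nonneg (gauss_pos y).le (Real.exp_pos (‖a‖ * ‖y‖)).le)
    calc _ = |F y| * (gauss y * Real.exp (‖a‖ * ‖y‖)) := by ring
      _ ≤ _ := this
      _ = _ := by ring
  -- Expand exp(i⟪a, y⟫) in its power series and integrate termwise: each term is a multiple of a
  -- vanishing moment. This makes the Fourier transform of F · gauss zero.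
  have hzero : ∀ a : V, ∫ y, Complex.exp ((inner ℝ a y : ℝ) * Complex.I) * f y = 0 := by
    intro a
    have hs : ∀ x : ℝ, HasSum (fun n : ℕ => x ^ n / n.factorial) (Real.exp x) := fun x => by
      rw [Real.exp_eq_exp_ℝ]; exact NormedSpace.expSeries_div_hasSum_exp x
    have hsum := hasSum_integral_of_dominated_convergence (μ := (volume : Measure V))
      (F := fun (k : ℕ) y => (Complex.I ^ k / k.factorial) * ((F y * weight a k y : ℝ) : ℂ))
      (f := fun y => Complex.exp ((inner ℝ a y : ℝ) * Complex.I) * f y)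
      (fun k y => |F y * gauss y| * ((‖a‖ * ‖y‖) ^ k / k.factorial)) ?_ ?_ ?_ ?_ ?_
    · refine hsum.unique ?_
      have : ∀ k : ℕ, ∫ y, (Complex.I ^ k / k.factorial) * ((F y * weight a k y : ℝ) : ℂ) = 0 := by
        intro k
        rw [integral_const_mul, integral_complex_ofReal, h a k, Complex.ofReal_zero, mul_zero]
      simp only [this]
      exact hasSum_zero
    · intro k
      exact (continuous_const.mul (Complex.continuous_ofReal.comp
        (hc.mul (continuous_weight a k)))).aestronglyMeasurable
    · refine fun k => .of_forall fun y => ?_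
      rw [norm_mul, norm_div, norm_pow, Complex.norm_I, one_pow, Complex.norm_real, weight,
        Complex.norm_natCast, Real.norm_eq_abs, mul_left_comm, abs_mul, abs_pow]
      have h1 : |inner ℝ a y| ^ k ≤ (‖a‖ * ‖y‖) ^ k :=
        pow_le_pow_left₀ (abs_nonneg _) (abs_real_inner_le_norm a y) k
      calc _ = |F y * gauss y| * (|inner ℝ a y| ^ k / k.factorial) := by ring
        _ ≤ _ := by gcongr
    · exact .of_forall fun y => ((hs _).mul_left _).summable
    · refine (hexp a).congr (.of_forall fun y => ?_)
      exact ((hs _).mul_left _).tsum_eq.symm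
    · refine .of_forall fun y => ?_
      have h1 : HasSum (fun n : ℕ => ((inner ℝ a y : ℝ) * Complex.I) ^ n / n.factorial)
          (Complex.exp ((inner ℝ a y : ℝ) * Complex.I)) := by
        rw [Complex.exp_eq_exp_ℂ]; exact NormedSpace.expSeries_div_hasSum_exp _
      convert! h1.mul_right (f y) using 2 with k
      simp only [hf, weight]
      push_cast
      ring
  have hF0 : 𝓕 f = 0 := by
    funext w
    rw [Real.fourier_eq']
    have := hzero ((-2 * Real.pi) • w)
    simp only [real_inner_smul_left] at this
    simpa only [smul_eq_mul, real_inner_comm w, Pi.zero_apply] using this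
  have hinv := hfc.fourierInv_fourier_eq hfi (by rw [hF0]; exact integrable_zero _ _ _)
  funext y
  have h1 : f y = 0 := by
    rw [← hinv, hF0, Real.fourierInv_eq]; simp
  have h2 : F y * gauss y = 0 := Complex.ofReal_eq_zero.1 h1
  exact (mul_eq_zero.1 h2).resolve_right (gauss_pos y).ne'

end Fourier

/-! ### Signs of the initial data and vanishing of the solution -/

section Conclusion

variable {d : ℕ} {μ : ℝ} {u : Space d → ℝ}

@[simp] theorem weight_zero (a : EuclideanSpace ℝ (Fin d)) : weight a 0 = gauss := by
  funext y; simp [weight]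

namespace IsEntireSolution

theorem moment_zero_nonneg (hu : IsEntireSolution μ u) : 0 ≤ moment u 0 0 0 :=
  integral_nonneg fun y => mul_nonneg (hu.nonneg _ (by simp [thinSpace]))
    (by rw [weight_zero]; exact (gauss_pos y).le)

/-- The difference quotients are dominated only from above, so they are replaced by their positive
parts, which tend pointwise to max(a, 0) = 0. -/
theorem deriv_moment_nonpos (hu : IsEntireSolution μ u) {p₀ : ℝ}
    (h : HasDerivWithinAt (moment u 0 0) p₀ (Ici 0) 0) : p₀ ≤ 0 := by
  obtain ⟨C, hC, N, hL⟩ := hu.exists_one_sided_lipschitz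
  have hslope : Tendsto (slope (moment u 0 0) 0) (𝓝[>] 0) (𝓝 p₀) := by
    have := hasDerivWithinAt_iff_tendsto_slope.1 h
    rwa [Ici_sdiff_left] at this
  set q : ℝ → EuclideanSpace ℝ (Fin d) → ℝ := fun s y => (u (point y s) - u (point y 0)) / s
  have hc : ∀ s : ℝ, Continuous fun y : EuclideanSpace ℝ (Fin d) => u (point y s) := fun s =>
    hu.continuous.comp (continuous_point_left s)
  have hqc : ∀ s, Continuous (q s) := fun s => ((hc s).sub (hc 0)).div_const s
  have hqle : ∀ s ∈ Ioc (0 : ℝ) 1, ∀ y, max (q s y) 0 ≤ C * (1 + ‖y‖) ^ N := by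
    intro s hs y
    refine max_le ?_ (by positivity)
    rw [div_le_iff₀ hs.1]
    exact hL y s hs
  have hgi : Integrable fun y : EuclideanSpace ℝ (Fin d) => C * (1 + ‖y‖) ^ N * gauss y :=
    ((polyBdd_const C).mul (polyBdd_pow N)).integrable_mul_gauss (by fun_prop)
  have hIoc : ∀ᶠ s : ℝ in 𝓝[>] 0, s ∈ Ioc (0 : ℝ) 1 := Ioc_mem_nhdsGT one_pos
  have hmeas : ∀ s, AEStronglyMeasurable (fun y => max (q s y) 0 * gauss y) volume := fun s =>
    (((hqc s).max continuous_const).mul continuous_gauss).aestronglyMeasurable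
  have hbd : ∀ s ∈ Ioc (0 : ℝ) 1, ∀ y, ‖max (q s y) 0 * gauss y‖ ≤ C * (1 + ‖y‖) ^ N * gauss y := by
    intro s hs y
    rw [Real.norm_of_nonneg (mul_nonneg (le_max_right _ _) (gauss_pos y).le)]
    exact mul_le_mul_of_nonneg_right (hqle s hs y) (gauss_pos y).le
  have hlim : Tendsto (fun s => ∫ y, max (q s y) 0 * gauss y) (𝓝[>] 0)
      (𝓝 (∫ _ : EuclideanSpace ℝ (Fin d), (0 : ℝ))) := by
    refine tendsto_integral_filter_of_dominated_convergence _ (.of_forall hmeas)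
      (hIoc.mono fun s hs => .of_forall (hbd s hs)) hgi (.of_forall fun y => ?_)
    obtain ⟨a, ha, hd⟩ := hu.deriv_nonpos (point y 0) (by simp [thinSpace])
    have h1 : Tendsto (fun s => q s y) (𝓝[>] 0) (𝓝 a) := by
      have h2 := hasDerivWithinAt_iff_tendsto_slope.1 hd
      rw [Ici_sdiff_left] at h2
      refine h2.congr fun s => ?_
      rw [slope_def_field]
      simp [q, point]
    simpa [max_eq_right ha] using
      (h1.max (tendsto_const_nhds (x := (0 : ℝ)))).mul_const (gauss y)
  rw [integral_zero] at hlim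
  refine le_of_tendsto_of_tendsto hslope hlim ?_
  filter_upwards [hIoc] with s hs
  have hi : ∀ s : ℝ, Integrable fun y : EuclideanSpace ℝ (Fin d) => u (point y s) * gauss y :=
    fun s => (hu.polyBdd_point s).integrable_mul_gauss (hc s)
  rw [slope_def_field, sub_zero]
  simp only [moment, weight_zero]
  rw [← integral_sub (hi s) (hi 0), ← integral_div]
  refine integral_mono (((hi s).sub (hi 0)).div_const s) (hgi.mono' (hmeas s)
    (.of_forall (hbd s hs))) fun y => ?_
  have : (u (point y s) * gauss y - u (point y 0) * gauss y) / s = q s y * gauss y := by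
    simp only [q]; ring
  rw [this]
  exact mul_le_mul_of_nonneg_right (le_max_left _ _) (gauss_pos y).le

theorem moment_eq_zero (hu : IsEntireSolution μ u) (a : EuclideanSpace ℝ (Fin d)) (k K : ℕ)
    (hk : ∀ s > 0, k * ((k - 1 : ℕ) * ‖a‖ ^ 2 * moment u a (k - 2) s) = 0) (hK : μ - k < K)
    (hμ : ∀ i < K, μ - k ≠ i)
    (hsign : ∀ p₀, HasDerivWithinAt (moment u a k) p₀ (Ici 0) 0 →
      0 ≤ moment u a k 0 * p₀ * ∏ i ∈ Finset.range K, ((i : ℝ) - (μ - k))) :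
    ∀ s > 0, moment u a k s = 0 := by
  have hm : ∀ s > 0, HasDerivAt (moment u a k) (momentDeriv u a k s) s :=
    fun s hs => hu.hasDerivAt_moment a k hs
  have hp : ∀ s > 0, HasDerivAt (momentDeriv u a k)
      (s * momentDeriv u a k s - (μ - k) * moment u a k s) s := by
    intro s hs
    have := hu.hasDerivAt_momentDeriv a k hs
    rwa [hu.integral_iteratedFDeriv_mul_weight a k hs, hk s hs, sub_zero] at this
  have hc := hu.continuous_moment a k
  obtain ⟨p₀, hp₀, hd⟩ := hermite_exists_tendsto_deriv hc.continuousOn hm hp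
  exact hermite_eq_zero K hm hp ((hc.tendsto 0).mono_left nhdsWithin_le_nhds) hp₀
    (hu.polyGrowth_moment a k).1 (hu.polyGrowth_moment a k).2 hK hμ (hsign p₀ hd)

theorem eq_zero_on_thinSpace (hu : IsEntireSolution μ u) {j : ℕ}
    (hj : μ ∈ Ioo (2 * (j : ℝ)) (2 * (j : ℝ) + 1)) (y : EuclideanSpace ℝ (Fin d)) :
    u (point y 0) = 0 := by
  have h0 : ∀ s > 0, moment u 0 0 s = 0 := by
    refine hu.moment_eq_zero 0 0 (2 * j + 1) (fun s _ => by simp) ?_ ?_ fun p₀ hp₀ => ?_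
    · push_cast; linarith [hj.2]
    · intro i hi h
      have : (i : ℝ) ≤ 2 * j := by exact_mod_cast (by omega : i ≤ 2 * j)
      rw [Nat.cast_zero, sub_zero] at h
      linarith [hj.1]
    -- All 2j + 1 factors i - μ are negative and their number is odd, so their product has the same
    -- sign as m_0(0) m_0'(0).
    · refine mul_nonneg_of_nonpos_of_nonpos (mul_nonpos_of_nonneg_of_nonpos hu.moment_zero_nonneg
        (hu.deriv_moment_nonpos hp₀)) ?_
      have h1 : ∏ i ∈ Finset.range (2 * j + 1), ((i : ℝ) - (μ - (0 : ℕ))) =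
          ∏ i ∈ Finset.range (2 * j + 1), (-1) * (μ - i) :=
        Finset.prod_congr rfl fun i _ => by push_cast; ring
      rw [h1, Finset.prod_mul_distrib, Finset.prod_const, Finset.card_range, pow_succ, pow_mul]
      have h2 : 0 ≤ ∏ i ∈ Finset.range (2 * j + 1), (μ - i) := by
        refine Finset.prod_nonneg fun i hi => ?_
        have : (i : ℝ) ≤ 2 * j := by
          exact_mod_cast (by have := Finset.mem_range.1 hi; omega : i ≤ 2 * j)
        linarith [hj.1]
      simpa using h2
  have h1 : moment u 0 0 0 = 0 := by
    refine tendsto_nhds_unique (((hu.continuous_moment 0 0).tendsto 0).mono_left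
      (nhdsWithin_le_nhds (s := Ioi 0))) ?_
    refine tendsto_const_nhds.congr' ?_
    filter_upwards [self_mem_nhdsWithin] with s hs using (h0 s hs).symm
  have hc : Continuous fun y : EuclideanSpace ℝ (Fin d) => u (point y 0) :=
    hu.continuous.comp (continuous_point_left 0)
  simp only [moment, weight_zero] at h1
  rw [integral_eq_zero_iff_of_nonneg (fun y => mul_nonneg (hu.nonneg _ (by simp [thinSpace]))
    (gauss_pos y).le) ((hu.polyBdd_point 0).integrable_mul_gauss hc)] at h1
  have h2 := ((hc.mul continuous_gauss).ae_eq_iff_eq volume continuous_zero).1 h1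
  have h3 : u (point y 0) * gauss y = 0 := congrFun h2 y
  exact (mul_eq_zero.1 h3).resolve_right (gauss_pos y).ne'

/-- Once u vanishes on the thin space, every moment starts at 0 and the sign of its derivative is
irrelevant; the strong induction on k removes the source term. -/
theorem eq_zero (hu : IsEntireSolution μ u) {j : ℕ}
    (hj : μ ∈ Ioo (2 * (j : ℝ)) (2 * (j : ℝ) + 1)) (x : Space d) : u x = 0 := by
  have hthin := hu.eq_zero_on_thinSpace hj
  have hmom : ∀ (a : EuclideanSpace ℝ (Fin d)) (k : ℕ), ∀ s > 0, moment u a k s = 0 := by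
    intro a k
    induction k using Nat.strong_induction_on with
    | _ k ih =>
      refine hu.moment_eq_zero a k (2 * j + 1) (fun s hs => ?_) ?_ ?_ fun p₀ _ => ?_
      · rcases lt_or_ge k 2 with hk | hk
        · interval_cases k <;> simp
        · rw [ih (k - 2) (by omega) s hs]; ring
      · push_cast; linarith [hj.2, (Nat.cast_nonneg k : (0 : ℝ) ≤ k)]
      -- Equality would make μ an integer strictly between 2j and 2j + 1.
      · intro i _ h
        have h1 : μ = ((i + k : ℕ) : ℝ) := by push_cast; linarith
        rw [h1] at hj
        have h2 : 2 * j < i + k := by exact_mod_cast hj.1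
        have h3 : i + k < 2 * j + 1 := by exact_mod_cast hj.2
        omega
      · have : moment u a k 0 = 0 := by simp [moment, hthin]
        simp [this]
  have hpos : ∀ (y : EuclideanSpace ℝ (Fin d)) (s : ℝ), 0 ≤ s → u (point y s) = 0 := by
    intro y s hs
    rcases hs.eq_or_lt with rfl | hs
    · exact hthin y
    · exact congrFun (eq_zero_of_integral_mul_weight_eq_zero
        (hu.continuous.comp (continuous_point_left s)) (hu.polyBdd_point s)
        fun a k => hmom a k s hs) y
  obtain ⟨y, hy⟩ := exists_eq_point x
  rcases le_total 0 (x (Fin.last d)) with h | h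
  · rw [hy]; exact hpos y _ h
  · have h1 : reflectLast x = point y (-x (Fin.last d)) := by
      conv_lhs => rw [hy]
      simp only [reflectLast, point_last]
      simp only [point]
      module
    rw [← hu.even x, h1]
    exact hpos y _ (by linarith)

end IsEntireSolution

end Conclusion

end ThinObstacle

theorem theorem1p2 (d : ℕ) (μ : ℝ) (u : ThinObstacle.Space d → ℝ)
    (hsol : ThinObstacle.IsSolution u) (hhom : ThinObstacle.IsHomogeneous μ u)
    (hne : ∃ x, u x ≠ 0) :
    μ ∉ ⋃ j : ℕ, Set.Ioo (2 * (j : ℝ)) (2 * (j : ℝ) + 1) := by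
  intro hμ
  obtain ⟨j, hj⟩ := Set.mem_iUnion.1 hμ
  obtain ⟨x, hx⟩ := hne
  exact hx ((hsol.isEntireSolution hhom).eq_zero hj x)
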